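/- Let $\Omega_0\subset\Omega\subset\mathbb C$ with $\Omega_0$ closed and $\Omega$ open, let $f$ be analytic on $\Omega\setminus\Omega_0$, and let $z_1,z_2\in\Omega_0$ with $z_1\ne z_2$. A *contour* is a simple closed piecewise $C^1$ loop or, more generally, a finite union of pairwise disjoint such loops; it encircles a point $p$ not on it (counterclockwise) if its winding number around $p$ is $1$, and $p$ is outside it if its winding number around $p$ is $0$. For contours $\Gamma_1,\Gamma_2$ in $\Omega\setminus\Omega_0$, $n\ge0$ and $N\ge 0$ put $$b_n(z_1,z_2)=\frac1{2\pi i(z_2-z_1)}\int_{\Gamma_1}\frac{f(w)\,dw}{(w-z_1)^n(w-z_2)^{n+1}},\qquad c_n(z_1,z_2)=\frac1{2\pi i(z_2-z_1)}\int_{\Gamma_2}(w-z_1)^{n+1}(w-z_2)^nf(w)\,dw,$$ let $b_n(z_2,z_1)$, $c_n(z_2,z_1)$ be the same expressions with $z_1$ and $z_2$ interchanged, and put $$r_N(z_1,z_2;z)=\frac{(z-z_1)^N(z-z_2)^N}{2\pi i}\int_{\Gamma_1}\frac{f(w)\,dw}{(w-z_1)^N(w-z_2)^N(w-z)}-\frac{1}{2\pi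 i\,(z-z_1)^N(z-z_2)^N}\int_{\Gamma_2}\frac{(w-z_1)^N(w-z_2)^Nf(w)\,dw}{w-z}.$$ (i) Let $z\in\Omega\setminus\Omega_0$, and let $\Gamma_1,\Gamma_2\subset\Omega\setminus\Omega_0$ be contours that both encircle $z_1$ and $z_2$ counterclockwise, such that $z$ is outside $\Gamma_2$, $\Gamma_1$ encircles $\Gamma_2$ and $z$, and the region between $\Gamma_1$ and $\Gamma_2$ lies in $\Omega\setminus\Omega_0$ (that is, $\Gamma_1$ and $\Gamma_2$ have the same winding number around every point not in $\Omega\setminus\Omega_0$). Then for every $N\ge0$ $$f(z)=\sum_{n=0}^{N-1}\left[b_n(z_1,z_2)(z-z_1)+b_n(z_2,z_1)(z-z_2)\right](z-z_1)^n(z-z_2)^n+\sum_{n=0}^{N-1}\left[c_n(z_1,z_2)(z-z_1)+c_n(z_2,z_1)(z-z_2)\right](z-z_1)^{-n-1}(z-z_2)^{-n-1}+r_N(z_1,z_2;z).$$ (ii) Let $$r_1=\inf_{w\in\mathbb C\setminus\Omega}|(w-z_1)(w-z_2)|,\qquad r_2=\sup_{w\in\Omega_0}|(w-z_1)(w-z_2)|$$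 (in $[0,\infty]$, with $r_1=\infty$ if $\Omega=\mathbb C$), and let $A=\{z\in\Omega\setminus\Omega_0:\ r_2<|(z-z_1)(z-z_2)|<r_1\}$ be the Cassini annulus. Let $\Gamma_1,\Gamma_2\subset\Omega\setminus\Omega_0$ be contours that encircle every point of $\Omega_0$ and have every point of $\mathbb C\setminus\Omega$ outside. Then, with coefficients computed from these contours, for every $z\in A$ both series of the expansion ($N\to\infty$) converge absolutely and their sum is $f(z)$; and if $\Gamma_1,\Gamma_2$ are also as in (i) for $z$, then $r_N(z_1,z_2;z)\to0$ as $N\to\infty$. (iii) For every $z\in A$ there are contours $\Gamma_1,\Gamma_2$ that satisfy the conditions of both (i) and (ii). Here $\Gamma_1$ can be taken to be a single simple closed loop if $4r_1>|z_1-z_2|^2$, and $\Gamma_2$ if $4|(z-z_1)(z-z_2)|>|z_1-z_2|^2$. -/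

import Mathlib

open Filter Topology Set
open scoped ENNReal

noncomputable section

namespace TwoPointLaurent

/-- A simple closed loop in the plane: a closed, piecewise continuously differentiable curve,
parametrized by `[0, 1]`, that is injective apart from the coincidence of its end points. -/
structure Loop where
  /-- The parametrization; only its values on `[0, 1]` matter. -/
  toFun : ℝ → ℂ
  piecewise_contDiff : ∃ (n : ℕ) (t : ℕ → ℝ), Monotone t ∧ t 0 = 0 ∧ t n = 1 ∧
    ∀ i < n, ContDiffOn ℝ 1 toFun (Icc (t i) (t (i + 1)))
  closed : toFun 0 = toFun 1
  simple : InjOn toFun (Ico 0 1)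

/-- The set of points of a loop. -/
def Loop.trace (γ : Loop) : Set ℂ := γ.toFun '' Icc 0 1

/-- `∫_γ g(w) dw`. -/
def Loop.integral (γ : Loop) (g : ℂ → ℂ) : ℂ :=
  ∫ t in (0 : ℝ)..1, g (γ.toFun t) * deriv γ.toFun t

/-- A contour of integration: a finite union of pairwise disjoint simple closed loops. A single
simple closed loop `γ` is the contour with `loops = [γ]`. Several loops are needed when the Cassini
ovals with foci `z₁`, `z₂` are disconnected. -/
structure Contour where
  loops : List Loop
  disjoint : loops.Pairwise (fun γ γ' => Disjoint γ.trace γ'.trace)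

/-- The set of points of a contour. -/
def Contour.trace (Γ : Contour) : Set ℂ := {w | ∃ γ ∈ Γ.loops, w ∈ γ.trace}

/-- `∫_Γ g(w) dw`. -/
def Contour.integral (Γ : Contour) (g : ℂ → ℂ) : ℂ :=
  (Γ.loops.map (fun γ => γ.integral g)).sum

/-- The winding number of a contour around a point that does not lie on it. -/
def Contour.winding (Γ : Contour) (p : ℂ) : ℂ :=
  1 / (2 * Real.pi * Complex.I) * Γ.integral (fun w => 1 / (w - p))

/-- `Γ` encircles `p` in the counterclockwise direction. -/
def Contour.Encircles (Γ : Contour) (p : ℂ) : Prop := p ∉ Γ.trace ∧ Γ.winding p = 1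

/-- `p` lies outside of `Γ`. -/
def Contour.Excludes (Γ : Contour) (p : ℂ) : Prop := p ∉ Γ.trace ∧ Γ.winding p = 0

/-- The coefficient `b_n(z₁, z₂)`, with `Γ = Γ₁`. -/
def coeffB (f : ℂ → ℂ) (Γ : Contour) (z₁ z₂ : ℂ) (n : ℕ) : ℂ :=
  1 / (2 * Real.pi * Complex.I * (z₂ - z₁)) *
    Γ.integral (fun w => f w / ((w - z₁) ^ n * (w - z₂) ^ (n + 1)))

/-- The coefficient `c_n(z₁, z₂)`, with `Γ = Γ₂`. -/
def coeffC (f : ℂ → ℂ) (Γ : Contour) (z₁ z₂ : ℂ) (n : ℕ) : ℂ :=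
  1 / (2 * Real.pi * Complex.I * (z₂ - z₁)) *
    Γ.integral (fun w => (w - z₁) ^ (n + 1) * (w - z₂) ^ n * f w)

/-- The `n`-th term with positive powers. -/
def termB (f : ℂ → ℂ) (Γ₁ : Contour) (z₁ z₂ z : ℂ) (n : ℕ) : ℂ :=
  (coeffB f Γ₁ z₁ z₂ n * (z - z₁) + coeffB f Γ₁ z₂ z₁ n * (z - z₂)) *
    ((z - z₁) ^ n * (z - z₂) ^ n)

/-- The `n`-th term with negative powers. -/
def termC (f : ℂ → ℂ) (Γ₂ : Contour) (z₁ z₂ z : ℂ) (n : ℕ) : ℂ :=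
  (coeffC f Γ₂ z₁ z₂ n * (z - z₁) + coeffC f Γ₂ z₂ z₁ n * (z - z₂)) *
    ((z - z₁) ^ (-(n : ℤ) - 1) * (z - z₂) ^ (-(n : ℤ) - 1))

/-- The remainder `r_N(z₁, z₂; z)`. -/
def remainder (f : ℂ → ℂ) (Γ₁ Γ₂ : Contour) (z₁ z₂ z : ℂ) (N : ℕ) : ℂ :=
  1 / (2 * Real.pi * Complex.I) *
      Γ₁.integral (fun w => f w / ((w - z₁) ^ N * (w - z₂) ^ N * (w - z))) *
      ((z - z₁) ^ N * (z - z₂) ^ N) -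
    1 / (2 * Real.pi * Complex.I) *
      Γ₂.integral (fun w => (w - z₁) ^ N * (w - z₂) ^ N * f w / (w - z)) *
      (1 / ((z - z₁) ^ N * (z - z₂) ^ N))

/-- `Γ₁`, `Γ₂` are nested contours in `Ω \ Ω₀` around `z₁` and `z₂`, with `z` inside `Γ₁` and
outside `Γ₂`, such that the region between them lies in `Ω \ Ω₀`. -/
structure Nested (Ω Ω₀ : Set ℂ) (z₁ z₂ z : ℂ) (Γ₁ Γ₂ : Contour) : Prop where
  subset₁ : Γ₁.trace ⊆ Ω \ Ω₀
  subset₂ : Γ₂.trace ⊆ Ω \ Ω₀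
  encircles₁ : Γ₁.Encircles z₁ ∧ Γ₁.Encircles z₂
  encircles₂ : Γ₂.Encircles z₁ ∧ Γ₂.Encircles z₂
  excludes : Γ₂.Excludes z
  encircles : Γ₁.Encircles z
  nested : ∀ w ∈ Γ₂.trace, Γ₁.Encircles w
  /-- No point outside `Ω \ Ω₀` lies between the two contours. -/
  between : ∀ w ∉ Ω \ Ω₀, Γ₁.winding w = Γ₂.winding w

/-- `Γ` lies in `Ω \ Ω₀`, encircles all of `Ω₀`, and its inside is contained in `Ω`. -/
structure Surrounds (Ω Ω₀ : Set ℂ) (Γ : Contour) : Prop where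
  subset : Γ.trace ⊆ Ω \ Ω₀
  encircles : ∀ w ∈ Ω₀, Γ.Encircles w
  excludes : ∀ w ∉ Ω, Γ.Excludes w

/-- `inf_{w ∉ Ω} |(w - z₁)(w - z₂)|`, which is `∞` if `Ω = ℂ`. -/
def outerRadius (Ω : Set ℂ) (z₁ z₂ : ℂ) : ℝ≥0∞ := ⨅ w ∈ Ωᶜ, ‖(w - z₁) * (w - z₂)‖ₑ

/-- `sup_{w ∈ Ω₀} |(w - z₁)(w - z₂)|`, which is `∞` if `Ω₀` is unbounded. -/
def innerRadius (Ω₀ : Set ℂ) (z₁ z₂ : ℂ) : ℝ≥0∞ := ⨆ w ∈ Ω₀, ‖(w - z₁) * (w - z₂)‖ₑ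

/-- The Cassini annulus. -/
def cassiniAnnulus (Ω Ω₀ : Set ℂ) (z₁ z₂ : ℂ) : Set ℂ :=
  {z | z ∈ Ω \ Ω₀ ∧ innerRadius Ω₀ z₁ z₂ < ‖(z - z₁) * (z - z₂)‖ₑ ∧
    ‖(z - z₁) * (z - z₂)‖ₑ < outerRadius Ω z₁ z₂}

end TwoPointLaurent

end

open TwoPointLaurent

namespace TwoPointLaurent

open MeasureTheory intervalIntegral

/-! Write `P(w) = (w - z₁)(w - z₂)`. Everything rests on `P(w) - P(z) = (w - z)(w + z - z₁ - z₂)`,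
together with the splitting `(z₂ - z₁)(w + z - z₁ - z₂) = (z - z₁)(w - z₁) - (z - z₂)(w - z₂)`.
Inserted in the two integrals of the remainder, they peel off one pair of terms: `r_N` is the sum of
the `N`-th terms and `r_{N+1}` (`remainder_eq_add`). For `N = 0` the expansion is Cauchy's formula
for a pair of contours, so (i) follows by induction.

Contours are restricted only through winding numbers, so Cauchy's theorem is needed in its homology
form. Dixon's argument gives it (`Contour.integral_dslope_eq`): the difference of the integrals of
the divided difference of `f` extends to an entire function that vanishes at infinity, hence is zero
by Liouville.

For (ii), on a Cassini oval `|P| = ρ` the terms and the remainder are bounded by geometric sequences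
with ratio `|P(z)| / ρ` outside and `ρ / |P(z)|` inside. By the homology theorem the coefficients
are the same for all surrounding contours, so convergence passes from ovals to arbitrary ones.

For (iii), let `m` be the midpoint and `a` half the difference of the foci, so that `P(w) = (w - m)²
- a²`. Solving `P(w) = ρ e^{iθ}` with the principal square root parametrizes the oval: two loops if
`ρ < |a|²`, one if `ρ > |a|²`. Its winding number around `p` equals that of the circle `|u| = ρ`
around `P(p)` (`exists_cassini_contour`). -/

/-! ### Integration along a loop -/

theorem Loop.continuousOn (γ : Loop) : ContinuousOn γ.toFun (Icc 0 1) := by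
  obtain ⟨n, t, ht, h0, h1, h⟩ := γ.piecewise_contDiff
  have key : ∀ k ≤ n, ContinuousOn γ.toFun (Icc 0 (t k)) := by
    intro k
    induction k with
    | zero => intro _; rw [h0, Icc_self]; exact continuousOn_singleton _ _
    | succ k ih =>
      intro hk
      rw [← Icc_union_Icc_eq_Icc (h0 ▸ ht (Nat.zero_le k)) (ht (Nat.le_succ k))]
      exact (ih (by omega)).union_of_isClosed (h k (by omega)).continuousOn isClosed_Icc isClosed_Icc
  rw [← h1]
  exact key n le_rfl

/-- At corners `deriv` carries no information, but these are finitely many points. Inside each piece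
it agrees with the one-sided derivative, which is continuous up to the ends. -/
theorem Loop.intervalIntegrable_deriv (γ : Loop) :
    IntervalIntegrable (deriv γ.toFun) volume 0 1 := by
  obtain ⟨n, t, ht, h0, h1, h⟩ := γ.piecewise_contDiff
  rw [← h0, ← h1]
  refine IntervalIntegrable.trans_iterate fun k hk => ?_
  -- The partition is only weakly monotone, so a piece may be a single point, where derivatives
  -- within the piece are not unique.
  rcases (ht (Nat.le_succ k)).eq_or_lt with he | hlt
  · rw [he]
  have hc : ContinuousOn (derivWithin γ.toFun (Icc (t k) (t (k + 1)))) (Icc (t k) (t (k + 1))) :=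
    (h k hk).continuousOn_derivWithin (uniqueDiffOn_Icc hlt) le_rfl
  have hi := hc.intervalIntegrable_of_Icc (μ := volume) hlt.le
  rw [intervalIntegrable_iff_integrableOn_Ioo_of_le hlt.le] at hi ⊢
  refine hi.congr_fun (fun x hx => ?_) measurableSet_Ioo
  exact derivWithin_of_mem_nhds (Icc_mem_nhds hx.1 hx.2)

theorem Loop.exists_countable_differentiableAt (γ : Loop) :
    ∃ s : Set ℝ, s.Countable ∧ ∀ x ∈ Ioo (0 : ℝ) 1 \ s, DifferentiableAt ℝ γ.toFun x := by
  obtain ⟨n, t, ht, h0, h1, h⟩ := γ.piecewise_contDiff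
  refine ⟨range t, countable_range t, fun x hx => ?_⟩
  have key : ∀ k ≤ n, x < t k → DifferentiableAt ℝ γ.toFun x := by
    intro k
    induction k with
    | zero => intro _ hk; rw [h0] at hk; exact absurd hx.1.1 (not_lt.2 hk.le)
    | succ k ih =>
      intro hk hxk
      rcases lt_trichotomy x (t k) with hlt | heq | hgt
      · exact ih (by omega) hlt
      · exact absurd ⟨k, heq.symm⟩ hx.2
      · exact ((h k (by omega)).differentiableOn one_ne_zero x ⟨hgt.le, hxk.le⟩).differentiableAt
          (Icc_mem_nhds hgt hxk)
  exact key n le_rfl (h1 ▸ hx.1.2)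

theorem Loop.isCompact_trace (γ : Loop) : IsCompact γ.trace :=
  isCompact_Icc.image_of_continuousOn γ.continuousOn

theorem Loop.mem_trace (γ : Loop) {t : ℝ} (ht : t ∈ Icc (0 : ℝ) 1) : γ.toFun t ∈ γ.trace :=
  mem_image_of_mem _ ht

theorem Loop.intervalIntegrable (γ : Loop) {g : ℂ → ℂ} (hg : ContinuousOn g γ.trace) :
    IntervalIntegrable (fun t => g (γ.toFun t) * deriv γ.toFun t) volume 0 1 := by
  refine γ.intervalIntegrable_deriv.continuousOn_mul ?_
  rw [uIcc_of_le zero_le_one]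
  exact hg.comp γ.continuousOn fun t ht => γ.mem_trace ht

theorem Loop.norm_integral_le (γ : Loop) {g : ℂ → ℂ} {M : ℝ} (hg : ∀ w ∈ γ.trace, ‖g w‖ ≤ M) :
    ‖γ.integral g‖ ≤ M * ∫ t in (0 : ℝ)..1, ‖deriv γ.toFun t‖ := by
  rw [← intervalIntegral.integral_const_mul]
  refine intervalIntegral.norm_integral_le_of_norm_le zero_le_one ?_
    (γ.intervalIntegrable_deriv.norm.const_mul M)
  refine Eventually.of_forall fun t ht => ?_
  rw [norm_mul]
  exact mul_le_mul_of_nonneg_right (hg _ (γ.mem_trace ⟨ht.1.le, ht.2⟩)) (norm_nonneg _)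

theorem Loop.integral_congr (γ : Loop) {g h : ℂ → ℂ} (H : EqOn g h γ.trace) :
    γ.integral g = γ.integral h := by
  refine intervalIntegral.integral_congr fun t ht => ?_
  rw [uIcc_of_le zero_le_one] at ht
  simp only [H (γ.mem_trace ht)]

theorem Loop.integral_add (γ : Loop) {g h : ℂ → ℂ} (hg : ContinuousOn g γ.trace)
    (hh : ContinuousOn h γ.trace) :
    γ.integral (fun w => g w + h w) = γ.integral g + γ.integral h := by
  simp only [Loop.integral, add_mul]
  exact intervalIntegral.integral_add (γ.intervalIntegrable hg) (γ.intervalIntegrable hh)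

theorem Loop.integral_const_mul (γ : Loop) (c : ℂ) (g : ℂ → ℂ) :
    γ.integral (fun w => c * g w) = c * γ.integral g := by
  simp only [Loop.integral, mul_assoc]
  exact intervalIntegral.integral_const_mul _ _

/-- The integral of an exact form over a loop vanishes. -/
theorem Loop.integral_eq_zero_of_hasDerivAt (γ : Loop) {F g : ℂ → ℂ}
    (hF : ∀ w ∈ γ.trace, HasDerivAt F (g w) w) (hg : ContinuousOn g γ.trace) :
    γ.integral g = 0 := by
  obtain ⟨s, hs, hd⟩ := γ.exists_countable_differentiableAt
  have := integral_eq_of_hasDerivAt_off_countable_of_le (fun t => F (γ.toFun t))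
    (fun t => g (γ.toFun t) * deriv γ.toFun t) zero_le_one hs ?_ ?_ (γ.intervalIntegrable hg)
  · rw [Loop.integral, this, γ.closed, sub_self]
  · exact ContinuousOn.comp (t := γ.trace) (fun w hw => (hF w hw).continuousAt.continuousWithinAt)
      γ.continuousOn fun t ht => γ.mem_trace ht
  · intro t ht
    exact (hF _ (γ.mem_trace (Ioo_subset_Icc_self ht.1))).comp_of_eq t (hd t ht).hasDerivAt rfl

/-- Holomorphic dependence of a loop integral on a parameter. -/
theorem Loop.differentiableAt_integral (γ : Loop) {φ : ℂ → ℂ → ℂ} {z₀ : ℂ} {r M : ℝ} (hr : 0 < r)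
    (hc : ∀ z ∈ Metric.ball z₀ r, ContinuousOn (φ z) γ.trace)
    (hd : ∀ w ∈ γ.trace, DifferentiableOn ℂ (fun z => φ z w) (Metric.ball z₀ r))
    (hM : ∀ z ∈ Metric.ball z₀ r, ∀ w ∈ γ.trace, ‖φ z w‖ ≤ M) :
    DifferentiableAt ℂ (fun z => γ.integral (φ z)) z₀ := by
  have hsub : ∀ t ∈ uIoc (0 : ℝ) 1, γ.toFun t ∈ γ.trace := fun t ht => by
    rw [uIoc_of_le zero_le_one] at ht
    exact γ.mem_trace ⟨ht.1.le, ht.2⟩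
  have hmeas : ∀ z ∈ Metric.ball z₀ r, AEStronglyMeasurable
      (fun t => φ z (γ.toFun t) * deriv γ.toFun t) (volume.restrict (uIoc (0 : ℝ) 1)) := fun z hz =>
    (intervalIntegrable_iff.1 (γ.intervalIntegrable (hc z hz))).aestronglyMeasurable
  have hz₀ : z₀ ∈ Metric.ball z₀ r := Metric.mem_ball_self hr
  have hda : ∀ t ∈ uIoc (0 : ℝ) 1, ∀ z ∈ Metric.ball z₀ r,
      HasDerivAt (fun z => φ z (γ.toFun t) * deriv γ.toFun t)
        (deriv (fun z => φ z (γ.toFun t)) z * deriv γ.toFun t) z := fun t ht z hz =>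
    (((hd _ (hsub t ht)).differentiableAt (Metric.isOpen_ball.mem_nhds hz)).hasDerivAt).mul_const _
  refine (intervalIntegral.hasDerivAt_integral_of_dominated_loc_of_deriv_le (μ := volume)
    (F := fun z t => φ z (γ.toFun t) * deriv γ.toFun t)
    (F' := fun z t => deriv (fun z => φ z (γ.toFun t)) z * deriv γ.toFun t)
    (bound := fun t => M / (r / 2) * ‖deriv γ.toFun t‖)
    (Metric.ball_mem_nhds z₀ (half_pos hr)) ?_ (γ.intervalIntegrable (hc z₀ hz₀)) ?_ ?_
    (γ.intervalIntegrable_deriv.norm.const_mul _) ?_).2.differentiableAt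
  · filter_upwards [Metric.ball_mem_nhds z₀ hr] with z hz using hmeas z hz
  -- The derivative of the integrand is measurable in `t` as the pointwise limit of difference
  -- quotients along a sequence `u n → 0`.
  · obtain ⟨u, hu0, hu⟩ : ∃ u : ℕ → ℂ, (∀ n, z₀ + u n ∈ Metric.ball z₀ r ∧ u n ≠ 0) ∧
        Tendsto u atTop (𝓝[≠] 0) := by
      have hpos : ∀ n : ℕ, (0 : ℝ) < r / 2 / (n + 1) := fun n => by positivity
      refine ⟨fun n => ((r / 2 / (n + 1) : ℝ) : ℂ), fun n => ⟨?_, ?_⟩, ?_⟩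
      · rw [Metric.mem_ball, dist_self_add_left, Complex.norm_real, Real.norm_of_nonneg (hpos n).le]
        have : r / 2 / (n + 1) ≤ r / 2 := div_le_self (by linarith) (by
          have := n.cast_nonneg (α := ℝ); linarith)
        linarith
      · exact Complex.ofReal_ne_zero.2 (hpos n).ne'
      · refine tendsto_nhdsWithin_iff.2 ⟨?_, Eventually.of_forall fun n =>
          Complex.ofReal_ne_zero.2 (hpos n).ne'⟩
        have h1 : Tendsto (fun n : ℕ => r / 2 / ((n : ℝ) + 1)) atTop (𝓝 0) :=
          tendsto_const_nhds.div_atTop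
            (tendsto_atTop_add_const_right _ _ tendsto_natCast_atTop_atTop)
        have h2 := (Complex.continuous_ofReal.tendsto 0).comp h1
        rwa [Complex.ofReal_zero] at h2
    refine aestronglyMeasurable_of_tendsto_ae atTop
      (f := fun n t => (u n)⁻¹ • (φ (z₀ + u n) (γ.toFun t) * deriv γ.toFun t -
        φ z₀ (γ.toFun t) * deriv γ.toFun t))
      (fun n => ((hmeas _ (hu0 n).1).sub (hmeas _ hz₀)).const_smul (u n)⁻¹) ?_
    refine (ae_restrict_iff' measurableSet_uIoc).2 (Eventually.of_forall fun t ht => ?_)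
    exact ((hasDerivAt_iff_tendsto_slope_zero.1 (hda t ht z₀ hz₀)).comp hu)
  · refine Eventually.of_forall fun t ht z hz => ?_
    rw [norm_mul]
    refine mul_le_mul_of_nonneg_right ?_ (norm_nonneg _)
    -- Cauchy's estimate on the disc of radius `r / 2` about `z` bounds the derivative by `M / (r /
    -- 2)`.
    have hsubset : Metric.closedBall z (r / 2) ⊆ Metric.ball z₀ r := by
      refine Metric.closedBall_subset_ball' ?_
      rw [Metric.mem_ball] at hz
      linarith
    refine Complex.norm_deriv_le_of_forall_mem_sphere_norm_le (half_pos hr) ?_ fun w hw =>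
      hM w (hsubset (Metric.sphere_subset_closedBall hw)) _ (hsub t ht)
    refine DifferentiableOn.diffContOnCl ?_
    rw [closure_ball _ (half_pos hr).ne']
    exact (hd _ (hsub t ht)).mono hsubset
  · exact Eventually.of_forall fun t ht z hz =>
      hda t ht z (Metric.ball_subset_ball (by linarith) hz)

/-! ### Integration along a contour -/

theorem Contour.trace_subset_of_mem {Γ : Contour} {γ : Loop} (hγ : γ ∈ Γ.loops) :
    γ.trace ⊆ Γ.trace := fun _ hw => ⟨γ, hγ, hw⟩

theorem Contour.trace_eq (Γ : Contour) : Γ.trace = ⋃ γ ∈ {γ | γ ∈ Γ.loops}, γ.trace := by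
  ext w
  simp [Contour.trace]

theorem Contour.isCompact_trace (Γ : Contour) : IsCompact Γ.trace := by
  rw [Γ.trace_eq]
  exact (List.finite_toSet Γ.loops).isCompact_biUnion fun γ _ => γ.isCompact_trace

/-- The total length of a contour. -/
noncomputable def Contour.length (Γ : Contour) : ℝ :=
  (Γ.loops.map fun γ => ∫ t in (0 : ℝ)..1, ‖deriv γ.toFun t‖).sum

theorem Contour.norm_integral_le (Γ : Contour) {g : ℂ → ℂ} {M : ℝ}
    (hg : ∀ w ∈ Γ.trace, ‖g w‖ ≤ M) : ‖Γ.integral g‖ ≤ M * Γ.length := by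
  have key : ∀ L : List Loop, (∀ γ ∈ L, ∀ w ∈ γ.trace, ‖g w‖ ≤ M) →
      ‖(L.map fun γ => γ.integral g).sum‖ ≤
        M * (L.map fun γ => ∫ t in (0 : ℝ)..1, ‖deriv γ.toFun t‖).sum := by
    intro L hL
    induction L with
    | nil => simp
    | cons γ L ih =>
      simp only [List.map_cons, List.sum_cons, mul_add]
      refine (norm_add_le _ _).trans (add_le_add (γ.norm_integral_le (hL γ (by simp))) ?_)
      exact ih fun γ' hγ' => hL γ' (by simp [hγ'])
  exact key Γ.loops fun γ hγ w hw => hg w ⟨γ, hγ, hw⟩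

theorem Contour.integral_congr (Γ : Contour) {g h : ℂ → ℂ} (H : EqOn g h Γ.trace) :
    Γ.integral g = Γ.integral h := by
  refine congrArg List.sum (List.map_congr_left fun γ hγ => ?_)
  exact γ.integral_congr (H.mono (Contour.trace_subset_of_mem hγ))

theorem Contour.integral_const_mul (Γ : Contour) (c : ℂ) (g : ℂ → ℂ) :
    Γ.integral (fun w => c * g w) = c * Γ.integral g := by
  simp only [Contour.integral, Loop.integral_const_mul]
  exact List.sum_map_mul_left _ _ _

theorem Contour.integral_add (Γ : Contour) {g h : ℂ → ℂ} (hg : ContinuousOn g Γ.trace)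
    (hh : ContinuousOn h Γ.trace) :
    Γ.integral (fun w => g w + h w) = Γ.integral g + Γ.integral h := by
  simp only [Contour.integral]
  rw [← List.sum_map_add]
  refine congrArg List.sum (List.map_congr_left fun γ hγ => ?_)
  exact γ.integral_add (hg.mono (Contour.trace_subset_of_mem hγ))
    (hh.mono (Contour.trace_subset_of_mem hγ))

theorem Contour.integral_sub (Γ : Contour) {g h : ℂ → ℂ} (hg : ContinuousOn g Γ.trace)
    (hh : ContinuousOn h Γ.trace) :
    Γ.integral (fun w => g w - h w) = Γ.integral g - Γ.integral h := by
  have := Γ.integral_add hg (hh.const_mul (-1))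
  rw [Γ.integral_const_mul] at this
  rw [sub_eq_add_neg, ← neg_one_mul (Γ.integral h), ← this]
  congr 1
  ext w
  ring

theorem Contour.integral_eq_zero_of_hasDerivAt (Γ : Contour) {F g : ℂ → ℂ}
    (hF : ∀ w ∈ Γ.trace, HasDerivAt F (g w) w) (hg : ContinuousOn g Γ.trace) :
    Γ.integral g = 0 := by
  refine List.sum_eq_zero fun x hx => ?_
  obtain ⟨γ, hγ, rfl⟩ := List.mem_map.1 hx
  exact γ.integral_eq_zero_of_hasDerivAt (fun w hw => hF w ⟨γ, hγ, hw⟩)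
    (hg.mono (Contour.trace_subset_of_mem hγ))

theorem Contour.differentiableAt_integral (Γ : Contour) {φ : ℂ → ℂ → ℂ} {z₀ : ℂ} {r M : ℝ}
    (hr : 0 < r) (hc : ∀ z ∈ Metric.ball z₀ r, ContinuousOn (φ z) Γ.trace)
    (hd : ∀ w ∈ Γ.trace, DifferentiableOn ℂ (fun z => φ z w) (Metric.ball z₀ r))
    (hM : ∀ z ∈ Metric.ball z₀ r, ∀ w ∈ Γ.trace, ‖φ z w‖ ≤ M) :
    DifferentiableAt ℂ (fun z => Γ.integral (φ z)) z₀ := by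
  have key : ∀ L : List Loop, (∀ γ ∈ L, γ.trace ⊆ Γ.trace) →
      DifferentiableAt ℂ (fun z => (L.map fun γ => γ.integral (φ z)).sum) z₀ := by
    intro L hL
    induction L with
    | nil => simp
    | cons γ L ih =>
      simp only [List.map_cons, List.sum_cons]
      have hγ := hL γ (by simp)
      refine DifferentiableAt.add ?_ (ih fun γ' hγ' => hL γ' (by simp [hγ']))
      exact γ.differentiableAt_integral hr (fun z hz => (hc z hz).mono hγ)
        (fun w hw => hd w (hγ hw)) fun z hz w hw => hM z hz w (hγ hw)
  exact key Γ.loops fun γ hγ => Contour.trace_subset_of_mem hγ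

/-! ### Cauchy integrals and the homology form of Cauchy's theorem -/

theorem Contour.continuousOn_div_sub (Γ : Contour) {f : ℂ → ℂ} (hf : ContinuousOn f Γ.trace) {z : ℂ}
    (hz : z ∉ Γ.trace) : ContinuousOn (fun w => f w / (w - z)) Γ.trace :=
  hf.div (continuousOn_id.sub continuousOn_const) fun _ hw => sub_ne_zero.2 fun h => hz (h ▸ hw)

theorem Contour.exists_ball_disjoint (Γ : Contour) {z : ℂ} (hz : z ∉ Γ.trace) :
    ∃ r > 0, ∀ w ∈ Γ.trace, r < ‖w - z‖ := by
  obtain ⟨r, hr, h⟩ := Metric.isOpen_iff.1 Γ.isCompact_trace.isClosed.isOpen_compl z hz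
  refine ⟨r / 2, half_pos hr, fun w hw => ?_⟩
  by_contra! hlt
  exact h (show w ∈ Metric.ball z r by rw [Metric.mem_ball, dist_eq_norm]; linarith) hw

theorem Contour.exists_norm_le (Γ : Contour) {f : ℂ → ℂ} (hf : ContinuousOn f Γ.trace) :
    ∃ M, 0 ≤ M ∧ ∀ w ∈ Γ.trace, ‖f w‖ ≤ M := by
  obtain ⟨M, hM⟩ := Γ.isCompact_trace.exists_bound_of_continuousOn hf
  exact ⟨max M 0, le_max_right _ _, fun w hw => (hM w hw).trans (le_max_left _ _)⟩

/-- Cauchy integrals are holomorphic off the contour. -/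
theorem Contour.differentiableAt_integral_div_sub (Γ : Contour) {f : ℂ → ℂ}
    (hf : ContinuousOn f Γ.trace) {z₀ : ℂ} (hz₀ : z₀ ∉ Γ.trace) :
    DifferentiableAt ℂ (fun z => Γ.integral fun w => f w / (w - z)) z₀ := by
  obtain ⟨r, hr, hball⟩ := Γ.exists_ball_disjoint hz₀
  obtain ⟨M, hM0, hM⟩ := Γ.exists_norm_le hf
  have hlow : ∀ z ∈ Metric.ball z₀ (r / 2), ∀ w ∈ Γ.trace, r / 2 ≤ ‖w - z‖ := by
    intro z hz w hw
    rw [Metric.mem_ball, dist_eq_norm] at hz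
    have := norm_sub_le_norm_sub_add_norm_sub w z z₀
    linarith [hball w hw]
  have hne : ∀ z ∈ Metric.ball z₀ (r / 2), ∀ w ∈ Γ.trace, w - z ≠ 0 := fun z hz w hw =>
    norm_pos_iff.1 ((half_pos hr).trans_le (hlow z hz w hw))
  refine Γ.differentiableAt_integral (φ := fun z w => f w / (w - z)) (M := M / (r / 2))
    (half_pos hr) (fun z hz => ?_) (fun w hw => ?_) fun z hz w hw => ?_
  · exact hf.div (continuousOn_id.sub continuousOn_const) (hne z hz)
  · exact (differentiableOn_const _).div ((differentiableOn_const _).sub differentiableOn_id)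
      fun z hz => hne z hz w hw
  · rw [norm_div]
    exact div_le_div₀ hM0 (hM w hw) (half_pos hr) (hlow z hz w hw)

/-- The integral of the divided difference is holomorphic, also on the contour. -/
theorem Contour.differentiableAt_integral_dslope (Γ : Contour) {f : ℂ → ℂ} {U : Set ℂ}
    (hU : IsOpen U) (hf : DifferentiableOn ℂ f U) (hΓ : Γ.trace ⊆ U) {z₀ : ℂ} (hz₀ : z₀ ∈ U) :
    DifferentiableAt ℂ (fun z => Γ.integral (dslope f z)) z₀ := by
  obtain ⟨R, hR, hball⟩ := Metric.isOpen_iff.1 hU z₀ hz₀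
  obtain ⟨M, hM0, hM⟩ := Γ.exists_norm_le (hf.continuousOn.mono hΓ)
  have hsub : Metric.closedBall z₀ (R / 2) ⊆ U :=
    (Metric.closedBall_subset_ball (by linarith)).trans hball
  obtain ⟨K, hK⟩ := (isCompact_closedBall z₀ (R / 2)).exists_bound_of_continuousOn
    (((hf.deriv hU).continuousOn).mono hsub)
  obtain ⟨B, hB⟩ := (isCompact_closedBall z₀ (R / 2)).exists_bound_of_continuousOn
    (hf.continuousOn.mono hsub)
  have hinball : ∀ z ∈ Metric.ball z₀ (R / 4), z ∈ Metric.closedBall z₀ (R / 2) := fun z hz =>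
    Metric.ball_subset_closedBall (Metric.ball_subset_ball (by linarith) hz)
  have hdiff : ∀ {z}, z ∈ U → DifferentiableOn ℂ (dslope f z) U := fun hz =>
    (Complex.differentiableOn_dslope (hU.mem_nhds hz)).2 hf
  -- Symmetry turns holomorphy in the point `w` into holomorphy in the parameter `z`.
  have hsymm : ∀ z w, dslope f z w = dslope f w z := by
    intro z w
    rcases eq_or_ne z w with rfl | h
    · rfl
    · rw [dslope_of_ne f h, dslope_of_ne f h.symm, slope_comm]
  -- For `w` within `R / 2` of `z₀` the mean value inequality gives the bound `K`. Any other `w` is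
  -- at distance at least `R / 4` from `z`, and the quotient is estimated directly.
  refine Γ.differentiableAt_integral (φ := fun z => dslope f z) (r := R / 4)
    (M := max K ((M + B) / (R / 4))) (by linarith)
    (fun z hz => ((hdiff (hsub (hinball z hz))).continuousOn).mono hΓ) (fun w hw => ?_)
    fun z hz w hw => ?_
  · simp only [fun z => hsymm z w]
    exact (hdiff (hΓ hw)).mono fun z hz => hsub (hinball z hz)
  · rcases eq_or_ne w z with rfl | hne
    · rw [dslope_same]
      exact (hK _ (hinball w hz)).trans (le_max_left _ _)
    rw [dslope_of_ne f hne, slope_def_field, norm_div]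
    have hpos : 0 < ‖w - z‖ := norm_pos_iff.2 (sub_ne_zero.2 hne)
    by_cases hw2 : w ∈ Metric.closedBall z₀ (R / 2)
    · refine le_max_of_le_left ((div_le_iff₀ hpos).2 ?_)
      exact (convex_closedBall z₀ (R / 2)).norm_image_sub_le_of_norm_deriv_le
        (fun x hx => hf.differentiableAt (hU.mem_nhds (hsub hx))) hK (hinball z hz) hw2
    · refine le_max_of_le_right (div_le_div₀ ?_ ?_ (by linarith) ?_)
      · exact add_nonneg hM0 ((norm_nonneg _).trans (hB _ (hinball z hz)))
      · exact (norm_sub_le _ _).trans (add_le_add (hM w hw) (hB _ (hinball z hz)))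
      · rw [Metric.mem_closedBall, dist_eq_norm, not_le] at hw2
        rw [Metric.mem_ball, dist_eq_norm] at hz
        have := norm_sub_le_norm_sub_add_norm_sub w z z₀
        linarith

/-- This is where the winding number enters: off the contour, the divided difference and the Cauchy
kernel differ by `f z` times the winding integrand. -/
theorem Contour.integral_dslope (Γ : Contour) {f : ℂ → ℂ} (hf : ContinuousOn f Γ.trace) {z : ℂ}
    (hz : z ∉ Γ.trace) :
    Γ.integral (dslope f z) =
      (Γ.integral fun w => f w / (w - z)) - f z * Γ.integral fun w => 1 / (w - z) := by
  rw [← Γ.integral_const_mul, ← Γ.integral_sub (Γ.continuousOn_div_sub hf hz)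
    ((Γ.continuousOn_div_sub continuousOn_const hz).const_mul _)]
  refine Γ.integral_congr fun w hw => ?_
  have hne : w ≠ z := fun h => hz (h ▸ hw)
  simp only [dslope_of_ne f hne, slope_def_field]
  ring

/-- The winding integral is locally constant off the contour. -/
theorem Contour.integral_one_div_sub_eventuallyEq (Γ : Contour) {p : ℂ} (hp : p ∉ Γ.trace) :
    ∀ᶠ z in 𝓝 p, (Γ.integral fun w => 1 / (w - z)) = Γ.integral fun w => 1 / (w - p) := by
  obtain ⟨r, hr, hball⟩ := Γ.exists_ball_disjoint hp
  filter_upwards [Metric.ball_mem_nhds p hr, Γ.isCompact_trace.isClosed.isOpen_compl.mem_nhds hp]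
    with z hz hzt
  rw [Metric.mem_ball, dist_eq_norm] at hz
  have c₁ := Γ.continuousOn_div_sub (f := fun _ => 1) continuousOn_const hzt
  have c₂ := Γ.continuousOn_div_sub (f := fun _ => 1) continuousOn_const hp
  rw [← sub_eq_zero, ← Γ.integral_sub c₁ c₂]
  -- For `z` close to `p` the quotient stays in the unit disc about `1`, so its principal logarithm
  -- is a primitive of the difference of the integrands.
  refine Γ.integral_eq_zero_of_hasDerivAt (F := fun w => Complex.log ((w - z) / (w - p)))
    (fun w hw => ?_) (c₁.sub c₂)
  have hwp : w - p ≠ 0 := norm_pos_iff.1 (hr.trans (hball w hw))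
  have hwz : w - z ≠ 0 := sub_ne_zero.2 fun h => hzt (h ▸ hw)
  have hslit : (w - z) / (w - p) ∈ Complex.slitPlane := by
    have : (w - z) / (w - p) = 1 + (p - z) / (w - p) := by field_simp; ring
    rw [this]
    refine Complex.mem_slitPlane_of_norm_lt_one ?_
    rw [norm_div, div_lt_one (norm_pos_iff.2 hwp), norm_sub_rev]
    exact hz.trans (hball w hw)
  have hquot : HasDerivAt (fun w => (w - z) / (w - p))
      ((1 * (w - p) - (w - z) * 1) / (w - p) ^ 2) w :=
    ((hasDerivAt_id w).sub_const z).div ((hasDerivAt_id w).sub_const p) hwp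
  convert hquot.clog hslit using 1
  field_simp

/-- If the contour lies in `|w| ≤ R < |z|`, then `(w - z) / (-z)` lies in the unit disc about `1`,
and its logarithm is a primitive of `1 / (w - z)`. -/
theorem Contour.eventually_integral_one_div_sub_eq_zero (Γ : Contour) :
    ∀ᶠ z in cocompact ℂ, z ∉ Γ.trace ∧ (Γ.integral fun w => 1 / (w - z)) = 0 := by
  obtain ⟨R, hR0, hR⟩ := Γ.exists_norm_le continuousOn_id
  have hlarge : ∀ᶠ z in cocompact ℂ, R < ‖z‖ :=
    (tendsto_norm_cocompact_atTop).eventually (eventually_gt_atTop R)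
  filter_upwards [hlarge] with z hz
  have hzt : z ∉ Γ.trace := fun h => absurd (hR z h) (not_le.2 hz)
  have hz0 : z ≠ 0 := norm_pos_iff.1 (hR0.trans_lt hz)
  refine ⟨hzt, Γ.integral_eq_zero_of_hasDerivAt (F := fun w => Complex.log ((w - z) / (-z)))
    (fun w hw => ?_) (Γ.continuousOn_div_sub continuousOn_const hzt)⟩
  have hwz : w - z ≠ 0 := sub_ne_zero.2 fun h => hzt (h ▸ hw)
  have hslit : (w - z) / (-z) ∈ Complex.slitPlane := by
    have : (w - z) / (-z) = 1 + w / (-z) := by field_simp; ring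
    rw [this]
    refine Complex.mem_slitPlane_of_norm_lt_one ?_
    rw [norm_div, norm_neg, div_lt_one (norm_pos_iff.2 hz0)]
    exact (hR w hw).trans_lt hz
  have hquot : HasDerivAt (fun w => (w - z) / (-z)) (1 / (-z)) w :=
    ((hasDerivAt_id w).sub_const z).div_const (-z)
  convert hquot.clog hslit using 1
  field_simp

theorem Contour.tendsto_integral_div_sub (Γ : Contour) {f : ℂ → ℂ} (hf : ContinuousOn f Γ.trace) :
    Tendsto (fun z => Γ.integral fun w => f w / (w - z)) (cocompact ℂ) (𝓝 0) := by
  obtain ⟨R, hR0, hR⟩ := Γ.exists_norm_le continuousOn_id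
  obtain ⟨M, hM0, hM⟩ := Γ.exists_norm_le hf
  have hlim : Tendsto (fun z : ℂ => M / (‖z‖ - R) * Γ.length) (cocompact ℂ) (𝓝 0) := by
    have : Tendsto (fun z : ℂ => M / (‖z‖ - R)) (cocompact ℂ) (𝓝 0) :=
      tendsto_const_nhds.div_atTop
        (tendsto_atTop_add_const_right _ (-R) tendsto_norm_cocompact_atTop)
    simpa using this.mul_const Γ.length
  refine squeeze_zero_norm' ?_ hlim
  have hlarge : ∀ᶠ z in cocompact ℂ, R < ‖z‖ :=
    (tendsto_norm_cocompact_atTop).eventually (eventually_gt_atTop R)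
  filter_upwards [hlarge] with z hz
  refine Γ.norm_integral_le fun w hw => ?_
  rw [norm_div]
  refine div_le_div₀ hM0 (hM w hw) (by linarith) ?_
  have h1 := norm_sub_norm_le z w
  rw [norm_sub_rev] at h1
  have := hR w hw
  simp only [id] at this
  linarith

/-- Homology form of Cauchy's theorem, after Dixon: if two contours in an open set `U` wind
equally often around each point of the complement of `U`, then the divided differences of a
holomorphic function on `U` have the same integrals over both. -/
theorem Contour.integral_dslope_eq {Γ₁ Γ₂ : Contour} {f : ℂ → ℂ} {U : Set ℂ} (hU : IsOpen U)
    (hf : DifferentiableOn ℂ f U) (h₁ : Γ₁.trace ⊆ U) (h₂ : Γ₂.trace ⊆ U)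
    (hw : ∀ p ∉ U, Γ₁.winding p = Γ₂.winding p) {z : ℂ} (hz : z ∈ U) :
    Γ₁.integral (dslope f z) = Γ₂.integral (dslope f z) := by
  classical
  have c₁ := hf.continuousOn.mono h₁
  have c₂ := hf.continuousOn.mono h₂
  have hw' : ∀ p ∉ U, (Γ₁.integral fun w => 1 / (w - p)) = Γ₂.integral fun w => 1 / (w - p) := by
    intro p hp
    have := hw p hp
    simp only [Contour.winding] at this
    exact mul_left_cancel₀ (by simp [Real.pi_ne_zero, Complex.I_ne_zero]) this
  let k : ℂ → ℂ := fun z =>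
    (Γ₁.integral fun w => f w / (w - z)) - Γ₂.integral fun w => f w / (w - z)
  -- Dixon's function. By `heq`, its two formulas agree at each point off both contours where the
  -- winding integrals coincide.
  let h : ℂ → ℂ := fun z =>
    if z ∈ U then Γ₁.integral (dslope f z) - Γ₂.integral (dslope f z) else k z
  have heq : ∀ {z}, z ∉ Γ₁.trace → z ∉ Γ₂.trace →
      ((Γ₁.integral fun w => 1 / (w - z)) = Γ₂.integral fun w => 1 / (w - z)) → h z = k z := by
    intro z hz₁ hz₂ he
    by_cases hzU : z ∈ U
    · simp only [h, if_pos hzU, k, Γ₁.integral_dslope c₁ hz₁, Γ₂.integral_dslope c₂ hz₂, he]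
      ring
    · simp only [h, if_neg hzU]
  have hdiff : Differentiable ℂ h := by
    intro z
    by_cases hzU : z ∈ U
    · refine ((Γ₁.differentiableAt_integral_dslope hU hf h₁ hzU).sub
        (Γ₂.differentiableAt_integral_dslope hU hf h₂ hzU)).congr_of_eventuallyEq ?_
      filter_upwards [hU.mem_nhds hzU] with y hy
      simp only [h, if_pos hy, Pi.sub_apply]
    · have hz₁ : z ∉ Γ₁.trace := fun h => hzU (h₁ h)
      have hz₂ : z ∉ Γ₂.trace := fun h => hzU (h₂ h)
      refine ((Γ₁.differentiableAt_integral_div_sub c₁ hz₁).sub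
        (Γ₂.differentiableAt_integral_div_sub c₂ hz₂)).congr_of_eventuallyEq ?_
      -- The winding integrals agree at `z ∉ U` and are locally constant, so `h = k` in a whole
      -- neighbourhood of `z`, including its points in `U`.
      filter_upwards [Γ₁.integral_one_div_sub_eventuallyEq hz₁,
        Γ₂.integral_one_div_sub_eventuallyEq hz₂,
        Γ₁.isCompact_trace.isClosed.isOpen_compl.mem_nhds hz₁,
        Γ₂.isCompact_trace.isClosed.isOpen_compl.mem_nhds hz₂] with y e₁ e₂ n₁ n₂
      exact heq n₁ n₂ (by rw [e₁, e₂, hw' z hzU])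
  have hlim : Tendsto h (cocompact ℂ) (𝓝 0) := by
    have hk : Tendsto k (cocompact ℂ) (𝓝 0) := by
      simpa using (Γ₁.tendsto_integral_div_sub c₁).sub (Γ₂.tendsto_integral_div_sub c₂)
    refine hk.congr' ?_
    filter_upwards [Γ₁.eventually_integral_one_div_sub_eq_zero,
      Γ₂.eventually_integral_one_div_sub_eq_zero] with y e₁ e₂
    exact (heq e₁.1 e₂.1 (by rw [e₁.2, e₂.2])).symm
  have := hdiff.apply_eq_of_tendsto_cocompact z hlim
  simp only [h, if_pos hz] at this
  exact sub_eq_zero.1 this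

/-- Homology form of Cauchy's theorem. -/
theorem Contour.integral_eq_of_winding_eq {Γ₁ Γ₂ : Contour} {f : ℂ → ℂ} {U : Set ℂ}
    (hU : IsOpen U) (hne : U.Nonempty) (hf : DifferentiableOn ℂ f U) (h₁ : Γ₁.trace ⊆ U)
    (h₂ : Γ₂.trace ⊆ U) (hw : ∀ p ∉ U, Γ₁.winding p = Γ₂.winding p) :
    Γ₁.integral f = Γ₂.integral f := by
  obtain ⟨z, hz⟩ := hne
  -- The divided difference of `(w - z) f(w)` based at `z` is `f` itself.
  have hd : DifferentiableOn ℂ (fun w => (w - z) * f w) U :=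
    ((differentiableOn_id).sub (differentiableOn_const z)).mul hf
  have hs : dslope (fun w => (w - z) * f w) z = fun w => if w = z then f z else f w := by
    ext w
    split_ifs with h
    · subst h
      rw [dslope_same]
      have : HasDerivAt (fun v => (v - w) * f v) (1 * f w + (w - w) * deriv f w) w :=
        ((hasDerivAt_id w).sub_const w).mul (hf.differentiableAt (hU.mem_nhds hz)).hasDerivAt
      simpa using this.deriv
    · rw [dslope_of_ne _ h, slope_def_field]
      have := sub_ne_zero.2 h
      field_simp
      ring
  have hs' : (fun w => if w = z then f z else f w) = f := by
    ext w
    split_ifs with h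
    · rw [h]
    · rfl
  have := Contour.integral_dslope_eq hU hd h₁ h₂ hw hz
  rwa [hs, hs'] at this

/-- Homology form of Cauchy's integral formula. -/
theorem Contour.integral_div_sub_sub {Γ₁ Γ₂ : Contour} {f : ℂ → ℂ} {U : Set ℂ} (hU : IsOpen U)
    (hf : DifferentiableOn ℂ f U) (h₁ : Γ₁.trace ⊆ U) (h₂ : Γ₂.trace ⊆ U)
    (hw : ∀ p ∉ U, Γ₁.winding p = Γ₂.winding p) {z : ℂ} (hz : z ∈ U) (hz₁ : Γ₁.Encircles z)
    (hz₂ : Γ₂.Excludes z) :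
    f z = 1 / (2 * Real.pi * Complex.I) * (Γ₁.integral fun w => f w / (w - z)) -
      1 / (2 * Real.pi * Complex.I) * Γ₂.integral fun w => f w / (w - z) := by
  have key := Contour.integral_dslope_eq hU hf h₁ h₂ hw hz
  rw [Γ₁.integral_dslope (hf.continuousOn.mono h₁) hz₁.1,
    Γ₂.integral_dslope (hf.continuousOn.mono h₂) hz₂.1] at key
  have e₁ := hz₁.2
  have e₂ := hz₂.2
  simp only [Contour.winding] at e₁ e₂
  linear_combination -(1 / (2 * Real.pi * Complex.I)) * key - f z * e₁ + f z * e₂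

/-! ### The unit circle and its winding integrals -/

/-- The parametrization `t ↦ e^{2πit}` of the unit circle. -/
noncomputable def expTurn (t : ℝ) : ℂ := Complex.exp (2 * Real.pi * t * Complex.I)

theorem expTurn_ne_zero (t : ℝ) : expTurn t ≠ 0 := Complex.exp_ne_zero _

theorem norm_expTurn (t : ℝ) : ‖expTurn t‖ = 1 := by
  have : (2 * Real.pi * t * Complex.I : ℂ) = ((2 * Real.pi * t : ℝ) : ℂ) * Complex.I := by
    push_cast; ring
  rw [expTurn, this, Complex.norm_exp_ofReal_mul_I]

theorem expTurn_add (s t : ℝ) : expTurn (s + t) = expTurn s * expTurn t := by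
  rw [expTurn, expTurn, expTurn, ← Complex.exp_add]
  congr 1
  push_cast
  ring

theorem expTurn_zero : expTurn 0 = 1 := by simp [expTurn]

theorem expTurn_half : expTurn (1 / 2) = -1 := by
  rw [expTurn, ← Complex.exp_pi_mul_I]
  congr 1
  push_cast
  ring

theorem expTurn_one : expTurn 1 = 1 := by
  rw [show (1 : ℝ) = 1 / 2 + 1 / 2 by norm_num, expTurn_add, expTurn_half]
  norm_num

theorem expTurn_two_mul (t : ℝ) : expTurn (2 * t) = expTurn t ^ 2 := by
  rw [two_mul, expTurn_add, sq]

theorem expTurn_neg (t : ℝ) : expTurn (-t) = (expTurn t)⁻¹ := by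
  refine eq_inv_of_mul_eq_one_left ?_
  rw [← expTurn_add, neg_add_cancel, expTurn_zero]

theorem expTurn_injOn : InjOn expTurn (Ico 0 1) := by
  intro s hs t ht h
  obtain ⟨n, hn⟩ := Complex.exp_eq_exp_iff_exists_int.1 h
  have h1 : (s : ℂ) = t + n := by
    refine mul_left_cancel₀ Complex.two_pi_I_ne_zero ?_
    linear_combination hn
  have h2 : s = t + n := by exact_mod_cast h1
  have h3 : (-1 : ℝ) < n := by linarith [hs.1, ht.2]
  have h4 : (n : ℝ) < 1 := by linarith [hs.2, ht.1]
  have h5 : -1 < n := by exact_mod_cast h3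
  have h6 : n < 1 := by exact_mod_cast h4
  have : n = 0 := by omega
  rw [h2, this, Int.cast_zero, add_zero]

theorem contDiff_expTurn : ContDiff ℝ 1 expTurn := by
  unfold expTurn
  exact Complex.contDiff_exp.comp ((contDiff_const.mul Complex.ofRealCLM.contDiff).mul contDiff_const)

theorem hasDerivAt_expTurn (t : ℝ) :
    HasDerivAt expTurn (2 * Real.pi * Complex.I * expTurn t) t := by
  have h : HasDerivAt (fun t : ℝ => (2 * Real.pi * t * Complex.I : ℂ))
      (2 * Real.pi * 1 * Complex.I) t :=
    (((hasDerivAt_id t).ofReal_comp).const_mul _).mul_const _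
  refine HasDerivAt.congr_deriv (f := expTurn) h.cexp ?_
  rw [expTurn]
  ring

theorem periodic_expTurn : Function.Periodic expTurn 1 := fun t => by
  rw [expTurn_add, expTurn_one, mul_one]

/-- The logarithmic integral over a circle centered at the origin. -/
theorem integral_expTurn_div {ρ : ℝ} (c : ℂ) :
    ∫ t in (0 : ℝ)..1, 2 * Real.pi * Complex.I * (ρ * expTurn t) / (ρ * expTurn t - c) =
      ∮ z in C(0, ρ), (z - c)⁻¹ := by
  have h := intervalIntegral.integral_comp_mul_left (a := 0) (b := 1)
    (fun θ => deriv (circleMap 0 ρ) θ • (circleMap 0 ρ θ - c)⁻¹) Real.two_pi_pos.ne'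
  rw [mul_zero, mul_one] at h
  rw [circleIntegral, ← smul_inv_smul₀ Real.two_pi_pos.ne' (∫ θ in (0 : ℝ)..2 * Real.pi, _), ← h,
    ← intervalIntegral.integral_smul]
  refine intervalIntegral.integral_congr fun t _ => ?_
  have : circleMap 0 ρ (2 * Real.pi * t) = ρ * expTurn t := by
    simp [circleMap, expTurn]
  simp only [deriv_circleMap, this, smul_eq_mul, Complex.real_smul]
  push_cast
  ring

theorem integral_expTurn_div_of_norm_lt {ρ : ℝ} {c : ℂ} (hc : ‖c‖ < ρ) :
    ∫ t in (0 : ℝ)..1, 2 * Real.pi * Complex.I * (ρ * expTurn t) / (ρ * expTurn t - c) =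
      2 * Real.pi * Complex.I := by
  rw [integral_expTurn_div, circleIntegral.integral_sub_inv_of_mem_ball (by simpa using hc)]

theorem integral_expTurn_div_of_lt_norm {ρ : ℝ} (hρ : 0 ≤ ρ) {c : ℂ} (hc : ρ < ‖c‖) :
    ∫ t in (0 : ℝ)..1, 2 * Real.pi * Complex.I * (ρ * expTurn t) / (ρ * expTurn t - c) = 0 := by
  have hne : ∀ z ∈ Metric.closedBall (0 : ℂ) ρ, z - c ≠ 0 := fun z hz h => by
    rw [sub_eq_zero.1 h, mem_closedBall_zero_iff] at hz
    linarith
  rw [integral_expTurn_div]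
  refine Complex.circleIntegral_eq_zero_of_differentiable_on_off_countable hρ countable_empty
    ?_ fun z hz => ?_
  · exact (continuousOn_id.sub continuousOn_const).inv₀ hne
  · exact (differentiableAt_id.sub_const c).inv (hne z (Metric.ball_subset_closedBall hz.1))

/-! ### Square roots and the parametrization of Cassini ovals -/

/-- The principal branch of the square root, on the slit plane. -/
noncomputable def principalSqrt (u : ℂ) : ℂ := Complex.exp (Complex.log u / 2)

theorem principalSqrt_sq {u : ℂ} (hu : u ≠ 0) : principalSqrt u ^ 2 = u := by
  rw [principalSqrt, ← Complex.exp_nat_mul, Nat.cast_ofNat, mul_div_cancel₀ _ two_ne_zero,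
    Complex.exp_log hu]

theorem principalSqrt_ne_zero (u : ℂ) : principalSqrt u ≠ 0 := Complex.exp_ne_zero _

/-- The argument is halved into `(-π/2, π/2)`. Positivity later separates the two components `m ± a
√(…)` of a disconnected oval. -/
theorem principalSqrt_re_pos {u : ℂ} (hu : u ∈ Complex.slitPlane) : 0 < (principalSqrt u).re := by
  have him : (Complex.log u / 2).im = u.arg / 2 := by
    rw [show (2 : ℂ) = ((2 : ℝ) : ℂ) by norm_num, Complex.div_ofReal_im, Complex.log_im]
  rw [principalSqrt, Complex.exp_re, him]
  refine mul_pos (Real.exp_pos _) (Real.cos_pos_of_mem_Ioo ⟨?_, ?_⟩)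
  · linarith [Complex.neg_pi_lt_arg u]
  · have := lt_of_le_of_ne (Complex.arg_le_pi u) (Complex.mem_slitPlane_iff_arg.1 hu).1
    linarith

theorem contDiffAt_principalSqrt {u : ℂ} (hu : u ∈ Complex.slitPlane) :
    ContDiffAt ℝ 1 principalSqrt u := by
  unfold principalSqrt
  exact Complex.contDiff_exp.contDiffAt.comp u
    (((Complex.contDiffAt_log hu).restrict_scalars ℝ).div_const 2)

theorem one_add_mul_expTurn_mem_slitPlane {q : ℂ} (hq : ‖q‖ < 1) (t : ℝ) :
    1 + q * expTurn t ∈ Complex.slitPlane := by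
  refine Complex.mem_slitPlane_of_norm_lt_one ?_
  rwa [norm_mul, norm_expTurn, mul_one]

/-- A continuously differentiable simple closed loop. -/
def Loop.ofContDiff (g : ℝ → ℂ) (hg : ContDiff ℝ 1 g) (hc : g 0 = g 1) (hs : InjOn g (Ico 0 1)) :
    Loop where
  toFun := g
  piecewise_contDiff := ⟨1, fun i => i, Nat.mono_cast, by simp, by simp, fun _ _ => hg.contDiffOn⟩
  closed := hc
  simple := hs

/-- One of the two components `m ± a √(1 + (ρ / a²) e^{2πit})` of a Cassini oval
`|(w - m)² - a²| = ρ` with `ρ < |a|²`. -/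
noncomputable def smallOval (m a : ℂ) (ρ : ℝ) (t : ℝ) : ℂ :=
  m + a * principalSqrt (1 + ρ / a ^ 2 * expTurn t)

/-- The Cassini oval `|(w - m)² - a²| = ρ` in the connected case `|a|² < ρ`. -/
noncomputable def largeOval (m a : ℂ) (ρ : ℝ) (t : ℝ) : ℂ :=
  m + √ρ * expTurn t * principalSqrt (1 + a ^ 2 / ρ * expTurn (-(2 * t)))

section Small

variable {m a : ℂ} {ρ : ℝ}

theorem norm_ratio_small (hρ : 0 < ρ) (h : ρ < ‖a‖ ^ 2) : ‖(ρ : ℂ) / a ^ 2‖ < 1 := by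
  rw [norm_div, norm_pow, Complex.norm_real, Real.norm_of_nonneg hρ.le, div_lt_one (hρ.trans h)]
  exact h

theorem ne_zero_of_small (hρ : 0 < ρ) (h : ρ < ‖a‖ ^ 2) : a ≠ 0 := by
  rintro rfl
  simp at h
  linarith

/-- Hence `(w - m)² - a²` runs once around the circle of radius `ρ`; this yields injectivity, the
level and the winding number. -/
theorem smallOval_sq (hρ : 0 < ρ) (h : ρ < ‖a‖ ^ 2) (t : ℝ) :
    (smallOval m a ρ t - m) ^ 2 = a ^ 2 + ρ * expTurn t := by
  have ha := ne_zero_of_small hρ h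
  rw [smallOval, add_sub_cancel_left, mul_pow, principalSqrt_sq
    (Complex.slitPlane_ne_zero (one_add_mul_expTurn_mem_slitPlane (norm_ratio_small hρ h) t))]
  field_simp

theorem contDiff_smallOval (hρ : 0 < ρ) (h : ρ < ‖a‖ ^ 2) : ContDiff ℝ 1 (smallOval m a ρ) := by
  refine contDiff_const.add (contDiff_const.mul (contDiff_iff_contDiffAt.2 fun t => ?_))
  exact (contDiffAt_principalSqrt
    (one_add_mul_expTurn_mem_slitPlane (norm_ratio_small hρ h) t)).comp (g := principalSqrt) t
    (contDiff_const.add (contDiff_const.mul contDiff_expTurn)).contDiffAt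

theorem smallOval_neg (t : ℝ) : smallOval m (-a) ρ t = 2 * m - smallOval m a ρ t := by
  simp only [smallOval, neg_sq]
  ring

/-- A component of a disconnected Cassini oval as a loop. -/
noncomputable def smallLoop (m a : ℂ) (ρ : ℝ) (hρ : 0 < ρ) (h : ρ < ‖a‖ ^ 2) : Loop :=
  Loop.ofContDiff (smallOval m a ρ) (contDiff_smallOval hρ h)
    (by simp only [smallOval, expTurn_zero, expTurn_one]) (by
      intro s hs t ht hst
      refine expTurn_injOn hs ht ?_
      have h1 := smallOval_sq (m := m) hρ h s
      rw [hst, smallOval_sq hρ h t] at h1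
      exact (mul_left_cancel₀ (Complex.ofReal_ne_zero.2 hρ.ne') (add_left_cancel h1)).symm)

end Small

section Large

variable {m a : ℂ} {ρ : ℝ}

theorem norm_ratio_large (hρ : 0 < ρ) (h : ‖a‖ ^ 2 < ρ) : ‖a ^ 2 / (ρ : ℂ)‖ < 1 := by
  rw [norm_div, norm_pow, Complex.norm_real, Real.norm_of_nonneg hρ.le, div_lt_one hρ]
  exact h

/-- Here `(w - m)² - a²` runs twice around the circle. Factoring out `ρ e^{4πit}` keeps the radicand
in the slit plane when `|a|² < ρ`. -/
theorem largeOval_sq (hρ : 0 < ρ) (h : ‖a‖ ^ 2 < ρ) (t : ℝ) :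
    (largeOval m a ρ t - m) ^ 2 = a ^ 2 + ρ * expTurn (2 * t) := by
  have hρ' : (ρ : ℂ) ≠ 0 := Complex.ofReal_ne_zero.2 hρ.ne'
  have hsq : ((√ρ : ℝ) : ℂ) ^ 2 = ρ := by exact_mod_cast Real.sq_sqrt hρ.le
  have he := expTurn_ne_zero t
  rw [largeOval, add_sub_cancel_left, mul_pow, mul_pow, hsq, principalSqrt_sq
    (Complex.slitPlane_ne_zero (one_add_mul_expTurn_mem_slitPlane (norm_ratio_large hρ h) _)),
    expTurn_neg, expTurn_two_mul]
  field_simp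
  ring

theorem contDiff_largeOval (hρ : 0 < ρ) (h : ‖a‖ ^ 2 < ρ) : ContDiff ℝ 1 (largeOval m a ρ) := by
  refine contDiff_const.add ((contDiff_const.mul contDiff_expTurn).mul
    (contDiff_iff_contDiffAt.2 fun t => ?_))
  exact (contDiffAt_principalSqrt
    (one_add_mul_expTurn_mem_slitPlane (norm_ratio_large hρ h) _)).comp (g := principalSqrt) t
    (contDiff_const.add (contDiff_const.mul (contDiff_expTurn.comp
      (contDiff_const.mul contDiff_id).neg))).contDiffAt

/-- Under a half period the radicand is unchanged and `expTurn` changes sign: the oval is centrally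
symmetric about `m`. -/
theorem largeOval_add_half (t : ℝ) : largeOval m a ρ (t + 1 / 2) = 2 * m - largeOval m a ρ t := by
  have : -(2 * (t + 1 / 2)) = -(2 * t) + -1 := by ring
  rw [largeOval, largeOval, this, expTurn_add, expTurn_add, expTurn_half, expTurn_neg 1,
    expTurn_one]
  simp only [inv_one, mul_one]
  ring

/-- A connected Cassini oval as a loop. -/
noncomputable def largeLoop (m a : ℂ) (ρ : ℝ) (hρ : 0 < ρ) (h : ‖a‖ ^ 2 < ρ) : Loop :=
  Loop.ofContDiff (largeOval m a ρ) (contDiff_largeOval hρ h)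
    (by
      simp only [largeOval, expTurn_neg, expTurn_two_mul, expTurn_zero, expTurn_one]) (by
      intro s hs t ht hst
      refine expTurn_injOn hs ht ?_
      have h1 := largeOval_sq (m := m) hρ h s
      rw [hst, largeOval_sq hρ h t] at h1
      -- The square determines only `e^{4πit}`; but then the square root factors coincide and
      -- cancel, which leaves `e^{2πit}`.
      have h2 := mul_left_cancel₀ (Complex.ofReal_ne_zero.2 hρ.ne') (add_left_cancel h1)
      simp only [largeOval, expTurn_neg, h2] at hst
      have h3 := mul_right_cancel₀ (principalSqrt_ne_zero _) (add_left_cancel hst)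
      exact mul_left_cancel₀ (Complex.ofReal_ne_zero.2 (Real.sqrt_pos.2 hρ).ne') h3)

end Large

/-! ### Winding numbers of Cassini ovals -/

/-- Partial fractions for the logarithmic derivative of `(X - m)² - (p - m)²`. -/
theorem logDeriv_add_logDeriv_reflect {m p X X' : ℂ} (h : (X - m) ^ 2 ≠ (p - m) ^ 2) :
    1 / (X - p) * X' + 1 / (2 * m - X - p) * (-X') =
      2 * (X - m) * X' / ((X - m) ^ 2 - (p - m) ^ 2) := by
  have h1 : X - p ≠ 0 := fun h' => h (by rw [sub_eq_zero.1 h'])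
  have h2 : 2 * m - X - p ≠ 0 := fun h' => h (by linear_combination (p - X) * h')
  have h3 := sub_ne_zero.2 h
  field_simp
  ring

/-- The derivative of `(γ - m)²` in terms of the curve that it parametrizes. -/
theorem two_mul_sub_mul_deriv {γ : ℝ → ℂ} {m a : ℂ} {ρ k : ℝ} (hγ : ContDiff ℝ 1 γ)
    (h : ∀ t, (γ t - m) ^ 2 = a ^ 2 + ρ * expTurn (k * t)) (t : ℝ) :
    2 * (γ t - m) * deriv γ t = k * (2 * Real.pi * Complex.I * (ρ * expTurn (k * t))) := by
  have h1 : HasDerivAt (fun t => (γ t - m) ^ 2) (2 * (γ t - m) ^ (2 - 1) * deriv γ t) t :=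
    ((hγ.differentiable one_ne_zero t).hasDerivAt.sub_const m).fun_pow 2
  have h2 : HasDerivAt (fun t => a ^ 2 + ρ * expTurn (k * t))
      (ρ * (k • (2 * Real.pi * Complex.I * expTurn (k * t)))) t :=
    (((hasDerivAt_expTurn (k * t)).scomp t
      (by simpa using (hasDerivAt_id t).const_mul k)).const_mul (ρ : ℂ)).const_add _
  rw [funext h] at h1
  have := h1.unique h2
  rw [Complex.real_smul] at this
  simp only [Nat.add_one_sub_one, pow_one] at this
  rw [this]
  ring

theorem norm_sq_sub_sq_smallOval {m a : ℂ} {ρ : ℝ} (hρ : 0 < ρ) (h : ρ < ‖a‖ ^ 2) (t : ℝ) :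
    ‖(smallOval m a ρ t - m) ^ 2 - a ^ 2‖ = ρ := by
  rw [smallOval_sq hρ h, add_sub_cancel_left, norm_mul, norm_expTurn, mul_one, Complex.norm_real,
    Real.norm_of_nonneg hρ.le]

theorem norm_sq_sub_sq_largeOval {m a : ℂ} {ρ : ℝ} (hρ : 0 < ρ) (h : ‖a‖ ^ 2 < ρ) (t : ℝ) :
    ‖(largeOval m a ρ t - m) ^ 2 - a ^ 2‖ = ρ := by
  rw [largeOval_sq hρ h, add_sub_cancel_left, norm_mul, norm_expTurn, mul_one, Complex.norm_real,
    Real.norm_of_nonneg hρ.le]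

theorem Loop.intervalIntegrable_one_div_sub (γ : Loop) {p : ℂ} (hp : p ∉ γ.trace) :
    IntervalIntegrable (fun t => 1 / (γ.toFun t - p) * deriv γ.toFun t) volume 0 1 :=
  γ.intervalIntegrable (g := fun w => 1 / (w - p)) (continuousOn_const.div
    (continuousOn_id.sub continuousOn_const) fun _ hw => sub_ne_zero.2 fun h => hp (h ▸ hw))

/-- The two loops are reflections of each other in `m`. Adding the integrands at reflected points
gives the logarithmic derivative of `(X - m)² - (p - m)²`, that is, of `ρ e^{2πit} - P(p)`. -/
theorem smallLoop_integral_add {m a : ℂ} {ρ : ℝ} (hρ : 0 < ρ) (h : ρ < ‖a‖ ^ 2)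
    (h' : ρ < ‖-a‖ ^ 2) {p : ℂ} (hp : ‖(p - m) ^ 2 - a ^ 2‖ ≠ ρ) :
    (smallLoop m a ρ hρ h).integral (fun w => 1 / (w - p)) +
        (smallLoop m (-a) ρ hρ h').integral (fun w => 1 / (w - p)) =
      ∫ t in (0 : ℝ)..1, 2 * Real.pi * Complex.I * (ρ * expTurn t) /
        (ρ * expTurn t - ((p - m) ^ 2 - a ^ 2)) := by
  have hpt : ∀ b (hb : ρ < ‖b‖ ^ 2), b ^ 2 = a ^ 2 → p ∉ (smallLoop m b ρ hρ hb).trace := by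
    rintro b hb hba ⟨t, -, rfl⟩
    refine hp ?_
    rw [← hba]
    exact norm_sq_sub_sq_smallOval hρ hb t
  simp only [Loop.integral]
  rw [← intervalIntegral.integral_add (Loop.intervalIntegrable_one_div_sub _ (hpt a h rfl))
    (Loop.intervalIntegrable_one_div_sub _ (hpt (-a) h' (neg_sq a)))]
  refine intervalIntegral.integral_congr fun t _ => ?_
  have hsq := smallOval_sq (m := m) hρ h t
  have hne : (smallOval m a ρ t - m) ^ 2 ≠ (p - m) ^ 2 := fun he =>
    hp (by rw [← he]; exact norm_sq_sub_sq_smallOval hρ h t)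
  have hder := two_mul_sub_mul_deriv (k := 1) (contDiff_smallOval (m := m) hρ h)
    (fun t => by rw [one_mul]; exact smallOval_sq hρ h t) t
  have hneg : smallOval m (-a) ρ = fun t => 2 * m - smallOval m a ρ t := funext smallOval_neg
  change 1 / (smallOval m a ρ t - p) * deriv (smallOval m a ρ) t +
    1 / (smallOval m (-a) ρ t - p) * deriv (smallOval m (-a) ρ) t = _
  rw [hneg, deriv_const_sub, logDeriv_add_logDeriv_reflect hne, hder, hsq, one_mul]
  push_cast
  ring

/-- The logarithmic integral over a curve that is symmetric about `m`. -/
theorem two_mul_integral_of_reflect {X : ℝ → ℂ} {m p : ℂ} (hX : ∀ t, X (t + 1 / 2) = 2 * m - X t)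
    (hint : IntervalIntegrable (fun t => 1 / (X t - p) * deriv X t) volume 0 1) :
    2 * ∫ t in (0 : ℝ)..1, 1 / (X t - p) * deriv X t =
      ∫ t in (0 : ℝ)..1, (1 / (X t - p) * deriv X t + 1 / (2 * m - X t - p) * (-deriv X t)) := by
  have hd : ∀ t, deriv X (t + 1 / 2) = -deriv X t := fun t => by
    rw [← deriv_comp_add_const, funext hX, deriv_const_sub]
  have hper : Function.Periodic (fun t => 1 / (X t - p) * deriv X t) 1 := fun t => by
    have h1 : X (t + 1) = X t := by
      rw [show t + 1 = t + 1 / 2 + 1 / 2 by ring, hX, hX]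
      ring
    have h2 : deriv X (t + 1) = deriv X t := by
      rw [show t + 1 = t + 1 / 2 + 1 / 2 by ring, hd, hd, neg_neg]
    simp only [h1, h2]
  have hsh : (fun t => 1 / (2 * m - X t - p) * (-deriv X t)) =
      fun t => 1 / (X (t + 1 / 2) - p) * deriv X (t + 1 / 2) := funext fun t => by rw [hX, hd]
  have hint' : IntervalIntegrable (fun t => 1 / (2 * m - X t - p) * (-deriv X t)) volume 0 1 := by
    rw [hsh]
    have := (hper.intervalIntegrable₀ one_ne_zero hint (1 / 2) (1 + 1 / 2)).comp_add_right (1 / 2)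
    rwa [sub_self, add_sub_cancel_right] at this
  rw [intervalIntegral.integral_add hint hint', hsh,
    intervalIntegral.integral_comp_add_right (fun t => 1 / (X t - p) * deriv X t), zero_add,
    add_comm (1 : ℝ) (1 / 2), hper.intervalIntegral_add_eq (1 / 2) 0, zero_add, two_mul]

theorem integral_comp_two_mul_of_periodic {Q : ℝ → ℂ} (hc : Continuous Q)
    (hp : Function.Periodic Q 1) :
    ∫ t in (0 : ℝ)..1, 2 * Q (2 * t) = 2 * ∫ t in (0 : ℝ)..1, Q t := by
  rw [intervalIntegral.integral_const_mul, intervalIntegral.integral_comp_mul_left _ two_ne_zero,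
    mul_zero, mul_one, ← intervalIntegral.integral_add_adjacent_intervals
      (hc.intervalIntegrable 0 1) (hc.intervalIntegrable 1 2)]
  have := hp.intervalIntegral_add_eq 1 0
  rw [zero_add, one_add_one_eq_two] at this
  rw [this, Complex.real_smul]
  push_cast
  ring

theorem largeLoop_integral {m a : ℂ} {ρ : ℝ} (hρ : 0 < ρ) (h : ‖a‖ ^ 2 < ρ) {p : ℂ}
    (hp : ‖(p - m) ^ 2 - a ^ 2‖ ≠ ρ) :
    (largeLoop m a ρ hρ h).integral (fun w => 1 / (w - p)) =
      ∫ t in (0 : ℝ)..1, 2 * Real.pi * Complex.I * (ρ * expTurn t) /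
        (ρ * expTurn t - ((p - m) ^ 2 - a ^ 2)) := by
  have hpt : p ∉ (largeLoop m a ρ hρ h).trace := by
    rintro ⟨t, -, rfl⟩
    exact hp (norm_sq_sub_sq_largeOval hρ h t)
  have hQcont : Continuous fun t => 2 * Real.pi * Complex.I * (ρ * expTurn t) /
      (ρ * expTurn t - ((p - m) ^ 2 - a ^ 2)) := by
    refine (continuous_const.mul (continuous_const.mul contDiff_expTurn.continuous)).div
      ((continuous_const.mul contDiff_expTurn.continuous).sub continuous_const) fun t he => hp ?_
    rw [← sub_eq_zero.1 he, norm_mul, norm_expTurn, mul_one, Complex.norm_real,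
      Real.norm_of_nonneg hρ.le]
  -- Doubling pairs each point of the oval with its reflection on the left, and matches the two
  -- turns around the circle on the right.
  refine mul_left_cancel₀ (two_ne_zero (α := ℂ)) ?_
  rw [← integral_comp_two_mul_of_periodic hQcont fun t => by rw [periodic_expTurn t]]
  have hint : IntervalIntegrable (fun t => 1 / (largeOval m a ρ t - p) *
      deriv (largeOval m a ρ) t) volume 0 1 :=
    Loop.intervalIntegrable_one_div_sub (largeLoop m a ρ hρ h) hpt
  change 2 * ∫ t in (0 : ℝ)..1, 1 / (largeOval m a ρ t - p) * deriv (largeOval m a ρ) t = _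
  rw [two_mul_integral_of_reflect largeOval_add_half hint]
  refine intervalIntegral.integral_congr fun t _ => ?_
  have hsq := largeOval_sq (m := m) hρ h t
  have hne : (largeOval m a ρ t - m) ^ 2 ≠ (p - m) ^ 2 := fun he =>
    hp (by rw [← he]; exact norm_sq_sub_sq_largeOval hρ h t)
  have hder := two_mul_sub_mul_deriv (contDiff_largeOval (m := m) hρ h)
    (fun t => largeOval_sq hρ h t) t
  simp only [logDeriv_add_logDeriv_reflect hne, hder, hsq]
  push_cast
  ring

/-- A nonsingular Cassini oval is a contour, which encircles the points of its sublevel set. -/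
theorem exists_cassini_contour (z₁ z₂ : ℂ) {ρ : ℝ} (hρ : 0 < ρ) (hne : 4 * ρ ≠ ‖(z₁ - z₂) ^ 2‖) :
    ∃ Γ : Contour, (∀ w ∈ Γ.trace, ‖(w - z₁) * (w - z₂)‖ = ρ) ∧
      (∀ p, ‖(p - z₁) * (p - z₂)‖ < ρ → Γ.Encircles p) ∧
      (∀ p, ρ < ‖(p - z₁) * (p - z₂)‖ → Γ.Excludes p) ∧
      (‖(z₁ - z₂) ^ 2‖ < 4 * ρ → ∃ γ : Loop, Γ.loops = [γ]) := by
  obtain ⟨m, a, rfl, rfl⟩ : ∃ m a, z₁ = m + a ∧ z₂ = m - a :=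
    ⟨(z₁ + z₂) / 2, (z₁ - z₂) / 2, by ring, by ring⟩
  have hP : ∀ w, (w - (m + a)) * (w - (m - a)) = (w - m) ^ 2 - a ^ 2 := fun w => by ring
  have hdist : ‖(m + a - (m - a)) ^ 2‖ = 4 * ‖a‖ ^ 2 := by
    rw [show m + a - (m - a) = 2 * a by ring, norm_pow, norm_mul, mul_pow]
    norm_num
  simp only [hP, hdist] at hne ⊢
  have hne' : ρ ≠ ‖a‖ ^ 2 := fun h => hne (by rw [h])
  -- The third factor of `H` is the single-loop clause; the second reduces the winding number around
  -- `p` to that of the circle `|u| = ρ` around `P(p) = (p - m)² - a²`. The singular level `ρ =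
  -- |a|²`, the lemniscate, is excluded.
  suffices H : ∃ Γ : Contour, (∀ w ∈ Γ.trace, ‖(w - m) ^ 2 - a ^ 2‖ = ρ) ∧
      (∀ p, ‖(p - m) ^ 2 - a ^ 2‖ ≠ ρ → (Γ.integral fun w => 1 / (w - p)) =
        ∫ t in (0 : ℝ)..1, 2 * Real.pi * Complex.I * (ρ * expTurn t) /
          (ρ * expTurn t - ((p - m) ^ 2 - a ^ 2))) ∧
      (4 * ‖a‖ ^ 2 < 4 * ρ → ∃ γ : Loop, Γ.loops = [γ]) by
    obtain ⟨Γ, ht, hi, hl⟩ := H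
    refine ⟨Γ, ht, fun p hp => ⟨fun h => hp.ne (ht p h), ?_⟩,
      fun p hp => ⟨fun h => hp.ne' (ht p h), ?_⟩, hl⟩
    · rw [Contour.winding, hi p hp.ne, integral_expTurn_div_of_norm_lt hp,
        one_div_mul_cancel Complex.two_pi_I_ne_zero]
    · rw [Contour.winding, hi p hp.ne', integral_expTurn_div_of_lt_norm hρ.le hp, mul_zero]
  rcases hne'.lt_or_gt with h | h
  · have h' : ρ < ‖-a‖ ^ 2 := by rwa [norm_neg]
    refine ⟨⟨[smallLoop m a ρ hρ h, smallLoop m (-a) ρ hρ h'], ?_⟩, ?_, fun p hp => ?_,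
      fun hlt => ?_⟩
    · simp only [List.pairwise_cons, List.mem_singleton, forall_eq, List.not_mem_nil,
        IsEmpty.forall_iff, implies_true, List.Pairwise.nil, and_true]
      rw [Set.disjoint_left]
      rintro _ ⟨s, -, rfl⟩ ⟨t, -, ht⟩
      have ha := ne_zero_of_small hρ h
      change m + -a * principalSqrt (1 + ρ / (-a) ^ 2 * expTurn t) =
        m + a * principalSqrt (1 + ρ / a ^ 2 * expTurn s) at ht
      rw [neg_sq] at ht
      -- A common point of the two loops would make two numbers of positive real part add up to
      -- zero.
      have h1 : a * (principalSqrt (1 + ρ / a ^ 2 * expTurn t) +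
          principalSqrt (1 + ρ / a ^ 2 * expTurn s)) = 0 := by linear_combination -ht
      have h2 := congrArg Complex.re ((mul_eq_zero.1 h1).resolve_left ha)
      have := principalSqrt_re_pos (one_add_mul_expTurn_mem_slitPlane (norm_ratio_small hρ h) t)
      have := principalSqrt_re_pos (one_add_mul_expTurn_mem_slitPlane (norm_ratio_small hρ h) s)
      rw [Complex.add_re, Complex.zero_re] at h2
      linarith
    · rintro w ⟨γ, hγ, t, -, rfl⟩
      rcases List.mem_pair.1 hγ with rfl | rfl
      · exact norm_sq_sub_sq_smallOval hρ h t
      · rw [← neg_sq a]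
        exact norm_sq_sub_sq_smallOval hρ h' t
    · rw [← smallLoop_integral_add hρ h h' hp]
      simp [Contour.integral]
    · linarith
  · refine ⟨⟨[largeLoop m a ρ hρ h], List.pairwise_singleton _ _⟩, ?_, fun p hp => ?_,
      fun _ => ⟨_, rfl⟩⟩
    · rintro w ⟨γ, hγ, t, -, rfl⟩
      rw [List.mem_singleton.1 hγ]
      exact norm_sq_sub_sq_largeOval hρ h t
    · rw [← largeLoop_integral hρ h hp]
      simp [Contour.integral]

/-! ### The expansion with remainder -/

theorem Contour.integral_linearCombination (Γ : Contour) {g g₁ g₂ g₃ : ℂ → ℂ} {a b c : ℂ}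
    (h₁ : ContinuousOn g₁ Γ.trace) (h₂ : ContinuousOn g₂ Γ.trace) (h₃ : ContinuousOn g₃ Γ.trace)
    (h : ∀ w ∈ Γ.trace, g w = a * g₁ w + b * g₂ w + c * g₃ w) :
    Γ.integral g = a * Γ.integral g₁ + b * Γ.integral g₂ + c * Γ.integral g₃ := by
  have h₁₂ : ContinuousOn (fun w => a * g₁ w + b * g₂ w) Γ.trace :=
    (h₁.const_mul a).add (h₂.const_mul b)
  rw [Γ.integral_congr h, Γ.integral_add h₁₂ (h₃.const_mul c),
    Γ.integral_add (h₁.const_mul a) (h₂.const_mul b), Γ.integral_const_mul, Γ.integral_const_mul,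
    Γ.integral_const_mul]

section Expansion

variable {Γ : Contour} {f : ℂ → ℂ} {z₁ z₂ z : ℂ}

theorem continuousOn_sub_pow (s : Set ℂ) (p : ℂ) (n : ℕ) : ContinuousOn (fun w => (w - p) ^ n) s :=
  (continuousOn_id.sub continuousOn_const).pow n

/-- Under the integral this is `1/(w - z) = P(z)/(P(w)(w - z)) + (w + z - z₁ - z₂)/P(w)`, divided by
`P(w)^N`, with the last numerator split between `w - z₁` and `w - z₂`. -/
theorem integral_outer_step (hf : ContinuousOn f Γ.trace) (hne : z₁ ≠ z₂) (h₁ : z₁ ∉ Γ.trace)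
    (h₂ : z₂ ∉ Γ.trace) (hz : z ∉ Γ.trace) (N : ℕ) :
    (Γ.integral fun w => f w / ((w - z₁) ^ N * (w - z₂) ^ N * (w - z))) =
      (z - z₁) * (z - z₂) *
          (Γ.integral fun w => f w / ((w - z₁) ^ (N + 1) * (w - z₂) ^ (N + 1) * (w - z))) +
        (z - z₁) / (z₂ - z₁) * (Γ.integral fun w => f w / ((w - z₁) ^ N * (w - z₂) ^ (N + 1))) +
        (z - z₂) / (z₁ - z₂) * (Γ.integral fun w => f w / ((w - z₂) ^ N * (w - z₁) ^ (N + 1))) := by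
  have n₁ : ∀ w ∈ Γ.trace, w - z₁ ≠ 0 := fun w hw => sub_ne_zero.2 fun h => h₁ (h ▸ hw)
  have n₂ : ∀ w ∈ Γ.trace, w - z₂ ≠ 0 := fun w hw => sub_ne_zero.2 fun h => h₂ (h ▸ hw)
  have n₃ : ∀ w ∈ Γ.trace, w - z ≠ 0 := fun w hw => sub_ne_zero.2 fun h => hz (h ▸ hw)
  refine Γ.integral_linearCombination ?_ ?_ ?_ fun w hw => ?_
  · exact hf.div (((continuousOn_sub_pow _ _ _).mul (continuousOn_sub_pow _ _ _)).mul
      (continuousOn_id.sub continuousOn_const)) fun w hw =>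
      mul_ne_zero (mul_ne_zero (pow_ne_zero _ (n₁ w hw)) (pow_ne_zero _ (n₂ w hw))) (n₃ w hw)
  · exact hf.div ((continuousOn_sub_pow _ _ _).mul (continuousOn_sub_pow _ _ _)) fun w hw =>
      mul_ne_zero (pow_ne_zero _ (n₁ w hw)) (pow_ne_zero _ (n₂ w hw))
  · exact hf.div ((continuousOn_sub_pow _ _ _).mul (continuousOn_sub_pow _ _ _)) fun w hw =>
      mul_ne_zero (pow_ne_zero _ (n₂ w hw)) (pow_ne_zero _ (n₁ w hw))
  · have a₁ := n₁ w hw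
    have a₂ := n₂ w hw
    have a₃ := n₃ w hw
    have a₄ : z₂ - z₁ ≠ 0 := sub_ne_zero.2 hne.symm
    have hsplit : (z - z₁) / (z₂ - z₁) * (f w / ((w - z₁) ^ N * (w - z₂) ^ (N + 1))) +
        (z - z₂) / (z₁ - z₂) * (f w / ((w - z₂) ^ N * (w - z₁) ^ (N + 1))) =
        f w * (w + z - z₁ - z₂) / ((w - z₁) ^ (N + 1) * (w - z₂) ^ (N + 1)) := by
      rw [← neg_sub z₂ z₁]
      field_simp
      ring
    rw [add_assoc, hsplit]
    field_simp
    ring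

/-- The same identity in the form `P(w)/(w - z) = P(z)/(w - z) + (w + z - z₁ - z₂)`, multiplied by
`P(w)^N`. -/
theorem integral_inner_step (hf : ContinuousOn f Γ.trace) (hne : z₁ ≠ z₂) (hz : z ∉ Γ.trace)
    (N : ℕ) :
    (Γ.integral fun w => (w - z₁) ^ (N + 1) * (w - z₂) ^ (N + 1) * f w / (w - z)) =
      (z - z₁) * (z - z₂) * (Γ.integral fun w => (w - z₁) ^ N * (w - z₂) ^ N * f w / (w - z)) +
        (z - z₁) / (z₂ - z₁) * (Γ.integral fun w => (w - z₁) ^ (N + 1) * (w - z₂) ^ N * f w) +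
        (z - z₂) / (z₁ - z₂) * (Γ.integral fun w => (w - z₂) ^ (N + 1) * (w - z₁) ^ N * f w) := by
  have n₃ : ∀ w ∈ Γ.trace, w - z ≠ 0 := fun w hw => sub_ne_zero.2 fun h => hz (h ▸ hw)
  refine Γ.integral_linearCombination ?_ ?_ ?_ fun w hw => ?_
  · exact (((continuousOn_sub_pow _ _ _).mul (continuousOn_sub_pow _ _ _)).mul hf).div
      (continuousOn_id.sub continuousOn_const) n₃
  · exact ((continuousOn_sub_pow _ _ _).mul (continuousOn_sub_pow _ _ _)).mul hf
  · exact ((continuousOn_sub_pow _ _ _).mul (continuousOn_sub_pow _ _ _)).mul hf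
  · have a₃ := n₃ w hw
    have a₄ : z₂ - z₁ ≠ 0 := sub_ne_zero.2 hne.symm
    have hsplit : (z - z₁) / (z₂ - z₁) * ((w - z₁) ^ (N + 1) * (w - z₂) ^ N * f w) +
        (z - z₂) / (z₁ - z₂) * ((w - z₂) ^ (N + 1) * (w - z₁) ^ N * f w) =
        (w + z - z₁ - z₂) * ((w - z₁) ^ N * (w - z₂) ^ N * f w) := by
      rw [← neg_sub z₂ z₁]
      field_simp
      ring
    rw [add_assoc, hsplit]
    field_simp
    ring

/-- The outer step yields the term with positive powers. The inner step, solved for its integral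
with exponent `N`, yields the term with negative powers. -/
theorem remainder_eq_add {Γ₁ Γ₂ : Contour} (hf₁ : ContinuousOn f Γ₁.trace)
    (hf₂ : ContinuousOn f Γ₂.trace) (hne : z₁ ≠ z₂) (h₁ : z₁ ∉ Γ₁.trace) (h₂ : z₂ ∉ Γ₁.trace)
    (hz₁ : z ∉ Γ₁.trace) (hz₂ : z ∉ Γ₂.trace) (hzz₁ : z ≠ z₁) (hzz₂ : z ≠ z₂) (N : ℕ) :
    remainder f Γ₁ Γ₂ z₁ z₂ z N =
      termB f Γ₁ z₁ z₂ z N + termC f Γ₂ z₁ z₂ z N + remainder f Γ₁ Γ₂ z₁ z₂ z (N + 1) := by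
  have a₁ := sub_ne_zero.2 hzz₁
  have a₂ := sub_ne_zero.2 hzz₂
  have a₃ : z₂ - z₁ ≠ 0 := sub_ne_zero.2 hne.symm
  have hpow : ∀ u : ℂ, u ^ (-(N : ℤ) - 1) = (u ^ (N + 1))⁻¹ := fun u => by
    rw [← zpow_natCast, ← zpow_neg]
    congr 1
    push_cast
    ring
  simp only [remainder, termB, termC, coeffB, coeffC, hpow]
  rw [integral_outer_step hf₁ hne h₁ h₂ hz₁ N, integral_inner_step hf₂ hne hz₂ N,
    ← neg_sub z₂ z₁]
  have hpi := Complex.two_pi_I_ne_zero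
  generalize (2 * Real.pi * Complex.I : ℂ) = k at hpi ⊢
  field_simp
  ring

end Expansion

theorem expansion_with_remainder {Ω Ω₀ : Set ℂ} (hU : IsOpen (Ω \ Ω₀)) {f : ℂ → ℂ}
    (hf : DifferentiableOn ℂ f (Ω \ Ω₀)) {z₁ z₂ z : ℂ} (hz₁ : z₁ ∈ Ω₀) (hz₂ : z₂ ∈ Ω₀)
    (hne : z₁ ≠ z₂) (hz : z ∈ Ω \ Ω₀) {Γ₁ Γ₂ : Contour} (h : Nested Ω Ω₀ z₁ z₂ z Γ₁ Γ₂) (N : ℕ) :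
    f z = ∑ n ∈ Finset.range N, termB f Γ₁ z₁ z₂ z n +
      ∑ n ∈ Finset.range N, termC f Γ₂ z₁ z₂ z n + remainder f Γ₁ Γ₂ z₁ z₂ z N := by
  induction N with
  | zero =>
    -- For `N = 0` the remainder is the difference of the two Cauchy integrals.
    rw [Contour.integral_div_sub_sub hU hf h.subset₁ h.subset₂ h.between hz h.encircles h.excludes]
    simp [remainder]
  | succ N ih =>
    rw [ih, remainder_eq_add (hf.continuousOn.mono h.subset₁) (hf.continuousOn.mono h.subset₂) hne
      h.encircles₁.1.1 h.encircles₁.2.1 h.encircles.1 h.excludes.1 (fun e => hz.2 (e ▸ hz₁))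
      (fun e => hz.2 (e ▸ hz₂)), Finset.sum_range_succ, Finset.sum_range_succ]
    ring

/-! ### Geometric estimates on Cassini ovals -/

section Estimates

variable {Γ : Contour} {f : ℂ → ℂ} {z₁ z₂ z : ℂ} {ρ : ℝ}

/-- The constant, a bound for `|g|` times the length, does not depend on `k`; so one `C` serves all
powers of `P`. -/
theorem Contour.exists_norm_integral_mul_le (Γ : Contour) {g : ℂ → ℂ}
    (hg : ContinuousOn g Γ.trace) :
    ∃ C, ∀ (k : ℂ → ℂ) (s : ℝ), (∀ w ∈ Γ.trace, ‖k w‖ = s) →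
      ‖Γ.integral fun w => g w * k w‖ ≤ C * s := by
  obtain ⟨M, hM0, hM⟩ := Γ.exists_norm_le hg
  refine ⟨M * Γ.length, fun k s hk => ?_⟩
  refine (Γ.norm_integral_le (M := M * s) fun w hw => ?_).trans_eq (by ring)
  rw [norm_mul, hk w hw]
  exact mul_le_mul_of_nonneg_right (hM w hw) (hk w hw ▸ norm_nonneg _)

theorem summable_of_norm_le_geometric {u : ℕ → ℂ} {C q : ℝ} (hq0 : 0 ≤ q) (hq : q < 1)
    (h : ∀ n, ‖u n‖ ≤ C * q ^ n) : Summable u :=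
  .of_norm_bounded ((summable_geometric_of_lt_one hq0 hq).mul_left C) h

/-- Integrals against negative powers of `(w - z₁)(w - z₂)` over a Cassini oval. -/
theorem exists_norm_integral_div_pow_le (hρ : ∀ w ∈ Γ.trace, ‖(w - z₁) * (w - z₂)‖ = ρ)
    {g : ℂ → ℂ} (hg : ContinuousOn g Γ.trace) :
    ∃ C, ∀ n, ‖(Γ.integral fun w => g w * (((w - z₁) * (w - z₂)) ^ n)⁻¹) *
      ((z - z₁) * (z - z₂)) ^ n‖ ≤ C * (‖(z - z₁) * (z - z₂)‖ / ρ) ^ n := by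
  obtain ⟨C, hC⟩ := Γ.exists_norm_integral_mul_le hg
  refine ⟨C, fun n => ?_⟩
  rw [norm_mul, norm_pow, div_pow, div_eq_inv_mul, ← mul_assoc]
  refine mul_le_mul_of_nonneg_right (hC _ _ fun w hw => ?_) (by positivity)
  rw [norm_inv, norm_pow, hρ w hw]

/-- Integrals against powers of `(w - z₁)(w - z₂)` over a Cassini oval. -/
theorem exists_norm_integral_pow_le (hρ : ∀ w ∈ Γ.trace, ‖(w - z₁) * (w - z₂)‖ = ρ)
    {g : ℂ → ℂ} (hg : ContinuousOn g Γ.trace) :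
    ∃ C, ∀ n, ‖(Γ.integral fun w => g w * ((w - z₁) * (w - z₂)) ^ n) *
      (((z - z₁) * (z - z₂)) ^ n)⁻¹‖ ≤ C * (ρ / ‖(z - z₁) * (z - z₂)‖) ^ n := by
  obtain ⟨C, hC⟩ := Γ.exists_norm_integral_mul_le hg
  refine ⟨C, fun n => ?_⟩
  rw [norm_mul, norm_inv, norm_pow, div_pow, div_eq_mul_inv, ← mul_assoc]
  refine mul_le_mul_of_nonneg_right (hC _ _ fun w hw => ?_) (by positivity)
  rw [norm_pow, hρ w hw]

/-- The integrand is the fixed function `f(w)/(w - z₂)` times `P(w)^{-n}`, which gives a geometric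
bound of ratio `|P(z)|/ρ < 1`. -/
theorem summable_coeffB_mul (hf : ContinuousOn f Γ.trace)
    (hρ : ∀ w ∈ Γ.trace, ‖(w - z₁) * (w - z₂)‖ = ρ) (hz : ‖(z - z₁) * (z - z₂)‖ < ρ) :
    Summable fun n => coeffB f Γ z₁ z₂ n * ((z - z₁) * (z - z₂)) ^ n := by
  have hρ0 : 0 < ρ := (norm_nonneg _).trans_lt hz
  have hne : ∀ w ∈ Γ.trace, w - z₂ ≠ 0 := fun w hw h => by
    have := hρ w hw
    rw [h, mul_zero, norm_zero] at this
    exact hρ0.ne this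
  obtain ⟨C, hC⟩ := exists_norm_integral_div_pow_le (z := z) hρ (g := fun w => f w / (w - z₂))
    (hf.div (continuousOn_id.sub continuousOn_const) hne)
  have := (summable_of_norm_le_geometric (div_nonneg (norm_nonneg _) hρ0.le)
    ((div_lt_one hρ0).2 hz) hC).mul_left (1 / (2 * Real.pi * Complex.I * (z₂ - z₁)))
  refine this.congr fun n => ?_
  have e : (Γ.integral fun w => f w / ((w - z₁) ^ n * (w - z₂) ^ (n + 1))) =
      Γ.integral fun w => f w / (w - z₂) * (((w - z₁) * (w - z₂)) ^ n)⁻¹ :=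
    Γ.integral_congr fun w _ => by
      simp only [mul_pow, pow_succ, div_eq_mul_inv, mul_inv]
      ring
  rw [coeffB, e, mul_assoc (1 / _)]

theorem summable_coeffC_mul (hf : ContinuousOn f Γ.trace)
    (hρ : ∀ w ∈ Γ.trace, ‖(w - z₁) * (w - z₂)‖ = ρ) (hρ0 : 0 < ρ)
    (hz : ρ < ‖(z - z₁) * (z - z₂)‖) :
    Summable fun n => coeffC f Γ z₁ z₂ n * (((z - z₁) * (z - z₂)) ^ n)⁻¹ := by
  obtain ⟨C, hC⟩ := exists_norm_integral_pow_le (z := z) hρ (g := fun w => (w - z₁) * f w)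
    ((continuousOn_id.sub (continuousOn_const (c := z₁))).mul hf)
  have := (summable_of_norm_le_geometric (div_nonneg hρ0.le (norm_nonneg _))
    ((div_lt_one (hρ0.trans hz)).2 hz) hC).mul_left (1 / (2 * Real.pi * Complex.I * (z₂ - z₁)))
  refine this.congr fun n => ?_
  have e : (Γ.integral fun w => (w - z₁) ^ (n + 1) * (w - z₂) ^ n * f w) =
      Γ.integral fun w => (w - z₁) * f w * ((w - z₁) * (w - z₂)) ^ n :=
    Γ.integral_congr fun w _ => by
      simp only [mul_pow]
      ring
  rw [coeffC, e, mul_assoc (1 / _)]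

theorem summable_termB (hf : ContinuousOn f Γ.trace)
    (hρ : ∀ w ∈ Γ.trace, ‖(w - z₁) * (w - z₂)‖ = ρ) (hz : ‖(z - z₁) * (z - z₂)‖ < ρ) :
    Summable (termB f Γ z₁ z₂ z) := by
  have h₁ := (summable_coeffB_mul hf hρ hz).mul_left (z - z₁)
  have h₂ := (summable_coeffB_mul (z₁ := z₂) (z₂ := z₁) (z := z) hf
    (fun w hw => by rw [mul_comm, hρ w hw]) (by rwa [mul_comm])).mul_left (z - z₂)
  refine (h₁.add h₂).congr fun n => ?_
  rw [termB, mul_pow, mul_pow]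
  ring

theorem summable_termC (hf : ContinuousOn f Γ.trace)
    (hρ : ∀ w ∈ Γ.trace, ‖(w - z₁) * (w - z₂)‖ = ρ) (hρ0 : 0 < ρ)
    (hz : ρ < ‖(z - z₁) * (z - z₂)‖) :
    Summable (termC f Γ z₁ z₂ z) := by
  have h₁ := (summable_coeffC_mul hf hρ hρ0 hz).mul_left ((z - z₁) * ((z - z₁) * (z - z₂))⁻¹)
  have h₂ := (summable_coeffC_mul (z₁ := z₂) (z₂ := z₁) (z := z) hf
    (fun w hw => by rw [mul_comm, hρ w hw]) hρ0 (by rwa [mul_comm])).mul_left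
      ((z - z₂) * ((z - z₁) * (z - z₂))⁻¹)
  refine (h₁.add h₂).congr fun n => ?_
  have hpow : ∀ u : ℂ, u ^ (-(n : ℤ) - 1) = (u ^ n)⁻¹ * u⁻¹ := fun u => by
    rw [← mul_inv, ← pow_succ, ← zpow_natCast, ← zpow_neg]
    congr 1
    push_cast
    ring
  rw [termC, hpow, hpow]
  simp only [mul_pow, mul_inv]
  ring

/-- Both parts have the same geometric bounds, now with the fixed factor `f(w)/(w - z)`, which is
continuous because `z` lies on neither level curve. -/
theorem tendsto_remainder {Γ₁ Γ₂ : Contour} {ρ₁ ρ₂ : ℝ} (hf₁ : ContinuousOn f Γ₁.trace)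
    (hf₂ : ContinuousOn f Γ₂.trace) (h₁ : ∀ w ∈ Γ₁.trace, ‖(w - z₁) * (w - z₂)‖ = ρ₁)
    (h₂ : ∀ w ∈ Γ₂.trace, ‖(w - z₁) * (w - z₂)‖ = ρ₂) (hz₁ : ‖(z - z₁) * (z - z₂)‖ < ρ₁)
    (hz₂ : ρ₂ < ‖(z - z₁) * (z - z₂)‖) (hρ₂ : 0 < ρ₂) :
    Tendsto (remainder f Γ₁ Γ₂ z₁ z₂ z) atTop (𝓝 0) := by
  have hρ₁ : 0 < ρ₁ := (norm_nonneg _).trans_lt hz₁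
  have g₁ := Γ₁.continuousOn_div_sub hf₁ fun h => hz₁.ne (h₁ z h)
  have g₂ := Γ₂.continuousOn_div_sub hf₂ fun h => hz₂.ne' (h₂ z h)
  obtain ⟨C, hC⟩ := exists_norm_integral_div_pow_le (z := z) h₁ g₁
  obtain ⟨D, hD⟩ := exists_norm_integral_pow_le (z := z) h₂ g₂
  have t₁ := (summable_of_norm_le_geometric (div_nonneg (norm_nonneg _) hρ₁.le)
    ((div_lt_one hρ₁).2 hz₁) hC).tendsto_atTop_zero.const_mul (1 / (2 * Real.pi * Complex.I))
  have t₂ := (summable_of_norm_le_geometric (div_nonneg hρ₂.le (norm_nonneg _))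
    ((div_lt_one (hρ₂.trans hz₂)).2 hz₂) hD).tendsto_atTop_zero.const_mul
      (1 / (2 * Real.pi * Complex.I))
  have t := t₁.sub t₂
  rw [mul_zero, sub_zero] at t
  refine t.congr fun N => ?_
  have e₁ : (Γ₁.integral fun w => f w / ((w - z₁) ^ N * (w - z₂) ^ N * (w - z))) =
      Γ₁.integral fun w => f w / (w - z) * (((w - z₁) * (w - z₂)) ^ N)⁻¹ :=
    Γ₁.integral_congr fun w _ => by
      simp only [mul_pow, mul_comm _ (w - z), div_eq_mul_inv, mul_inv, mul_assoc]
  have e₂ : (Γ₂.integral fun w => (w - z₁) ^ N * (w - z₂) ^ N * f w / (w - z)) =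
      Γ₂.integral fun w => f w / (w - z) * ((w - z₁) * (w - z₂)) ^ N :=
    Γ₂.integral_congr fun w _ => by
      simp only [mul_pow]
      ring
  rw [remainder, e₁, e₂, ← mul_pow, one_div ((_ : ℂ) ^ N), mul_assoc (1 / _), mul_assoc (1 / _)]

end Estimates

/-! ### Independence of the coefficients from the contour -/

section Independence

variable {Ω Ω₀ : Set ℂ} {Γ Γ' : Contour} {f : ℂ → ℂ} {z₁ z₂ : ℂ}

/-- A point outside `Ω \ Ω₀` lies in `Ω₀` or outside `Ω`, where both winding numbers are `1` or both
are `0`. -/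
theorem Surrounds.winding_eq (h : Surrounds Ω Ω₀ Γ) (h' : Surrounds Ω Ω₀ Γ') :
    ∀ p ∉ Ω \ Ω₀, Γ.winding p = Γ'.winding p := by
  intro p hp
  by_cases hpΩ : p ∈ Ω
  · have hp₀ : p ∈ Ω₀ := by_contra fun hn => hp ⟨hpΩ, hn⟩
    rw [(h.encircles p hp₀).2, (h'.encircles p hp₀).2]
  · rw [(h.excludes p hpΩ).2, (h'.excludes p hpΩ).2]

/-- The only poles of the kernel, `z₁` and `z₂`, lie in `Ω₀`, so the integrand is holomorphic on `Ω
\ Ω₀` and the homology theorem applies. -/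
theorem Surrounds.coeffB_eq (hU : IsOpen (Ω \ Ω₀)) (hUne : (Ω \ Ω₀).Nonempty)
    (hf : DifferentiableOn ℂ f (Ω \ Ω₀)) (h : Surrounds Ω Ω₀ Γ) (h' : Surrounds Ω Ω₀ Γ')
    (hz₁ : z₁ ∈ Ω₀) (hz₂ : z₂ ∈ Ω₀) (n : ℕ) : coeffB f Γ z₁ z₂ n = coeffB f Γ' z₁ z₂ n := by
  rw [coeffB, coeffB]
  congr 1
  refine Contour.integral_eq_of_winding_eq hU hUne ?_ h.subset h'.subset (h.winding_eq h')
  refine hf.div (by fun_prop) fun w hw => mul_ne_zero (pow_ne_zero _ ?_) (pow_ne_zero _ ?_)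
  · exact sub_ne_zero.2 fun e => hw.2 (e ▸ hz₁)
  · exact sub_ne_zero.2 fun e => hw.2 (e ▸ hz₂)

theorem Surrounds.coeffC_eq (hU : IsOpen (Ω \ Ω₀)) (hUne : (Ω \ Ω₀).Nonempty)
    (hf : DifferentiableOn ℂ f (Ω \ Ω₀)) (h : Surrounds Ω Ω₀ Γ) (h' : Surrounds Ω Ω₀ Γ') (n : ℕ) :
    coeffC f Γ z₁ z₂ n = coeffC f Γ' z₁ z₂ n := by
  rw [coeffC, coeffC]
  congr 1
  refine Contour.integral_eq_of_winding_eq hU hUne ?_ h.subset h'.subset (h.winding_eq h')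
  exact DifferentiableOn.mul (by fun_prop) hf

end Independence

/-! ### Cassini ovals inside the annulus -/

section Annulus

variable {Ω Ω₀ : Set ℂ} {z₁ z₂ z : ℂ}

theorem enorm_lt_ofReal_iff {x : ℂ} {ρ : ℝ} : ‖x‖ₑ < ENNReal.ofReal ρ ↔ ‖x‖ < ρ := by
  rw [← ofReal_norm, ENNReal.ofReal_lt_ofReal_iff_of_nonneg (norm_nonneg _)]

theorem ofReal_lt_enorm_iff {x : ℂ} {ρ : ℝ} (hρ : 0 ≤ ρ) :
    ENNReal.ofReal ρ < ‖x‖ₑ ↔ ρ < ‖x‖ := by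
  rw [← ofReal_norm, ENNReal.ofReal_lt_ofReal_iff_of_nonneg hρ]

theorem norm_lt_of_mem {ρ : ℝ} (h : innerRadius Ω₀ z₁ z₂ < ENNReal.ofReal ρ) {w : ℂ}
    (hw : w ∈ Ω₀) : ‖(w - z₁) * (w - z₂)‖ < ρ :=
  enorm_lt_ofReal_iff.1 ((le_iSup₂ (f := fun w (_ : w ∈ Ω₀) => ‖(w - z₁) * (w - z₂)‖ₑ) w hw).trans_lt h)

theorem lt_norm_of_notMem {ρ : ℝ} (hρ : 0 ≤ ρ) (h : ENNReal.ofReal ρ < outerRadius Ω z₁ z₂) {w : ℂ}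
    (hw : w ∉ Ω) : ρ < ‖(w - z₁) * (w - z₂)‖ :=
  (ofReal_lt_enorm_iff hρ).1
    (h.trans_le (iInf₂_le (f := fun w (_ : w ∈ Ωᶜ) => ‖(w - z₁) * (w - z₂)‖ₑ) w hw))

/-- A nonsingular Cassini oval between the two radii surrounds `Ω₀` in `Ω`. -/
theorem exists_cassini_surrounds {ρ : ℝ} (hρ : 0 < ρ) (hne : 4 * ρ ≠ ‖(z₁ - z₂) ^ 2‖)
    (hin : innerRadius Ω₀ z₁ z₂ < ENNReal.ofReal ρ)
    (hout : ENNReal.ofReal ρ < outerRadius Ω z₁ z₂) :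
    ∃ Γ : Contour, Surrounds Ω Ω₀ Γ ∧ (∀ w ∈ Γ.trace, ‖(w - z₁) * (w - z₂)‖ = ρ) ∧
      (∀ p, ‖(p - z₁) * (p - z₂)‖ < ρ → Γ.Encircles p) ∧
      (∀ p, ρ < ‖(p - z₁) * (p - z₂)‖ → Γ.Excludes p) ∧
      (‖(z₁ - z₂) ^ 2‖ < 4 * ρ → ∃ γ : Loop, Γ.loops = [γ]) := by
  obtain ⟨Γ, ht, he, hx, hl⟩ := exists_cassini_contour z₁ z₂ hρ hne
  refine ⟨Γ, ⟨fun w hw => ⟨?_, fun h => ?_⟩, fun w hw => he w (norm_lt_of_mem hin hw),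
    fun w hw => hx w (lt_norm_of_notMem hρ.le hout hw)⟩, ht, he, hx, hl⟩
  · by_contra h
    exact (lt_norm_of_notMem hρ.le hout h).ne' (ht w hw)
  · exact (norm_lt_of_mem hin h).ne (ht w hw)

/-- A number in a given interval that exceeds `d` whenever the upper end does. -/
theorem exists_real_between {a b : ℝ≥0∞} (hab : a < b) {d : ℝ} :
    ∃ ρ : ℝ, 0 < ρ ∧ a < ENNReal.ofReal ρ ∧ ENNReal.ofReal ρ < b ∧ ρ ≠ d ∧
      (ENNReal.ofReal d < b → d < ρ) := by
  have hpos : ∀ {ρ : ℝ}, a < ENNReal.ofReal ρ → 0 < ρ := fun h =>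
    ENNReal.ofReal_pos.1 (bot_le.trans_lt h)
  -- If `d` lies below `b`, choose `ρ` above both `a` and `d`; otherwise every `ρ` below `b` differs
  -- from `d`.
  by_cases hd : ENNReal.ofReal d < b
  · obtain ⟨ρ, -, h1, h2⟩ := ENNReal.lt_iff_exists_real_btwn.1 (max_lt hab hd)
    have hρ := hpos ((le_max_left _ _).trans_lt h1)
    have hdρ : d < ρ :=
      (ENNReal.ofReal_lt_ofReal_iff hρ).1 ((le_max_right _ _).trans_lt h1)
    exact ⟨ρ, hρ, (le_max_left _ _).trans_lt h1, h2, hdρ.ne', fun _ => hdρ⟩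
  · obtain ⟨ρ, -, h1, h2⟩ := ENNReal.lt_iff_exists_real_btwn.1 hab
    exact ⟨ρ, hpos h1, h1, h2, fun e => hd (e ▸ h2), fun h => absurd h hd⟩

theorem ofReal_quarter_lt {x : ℂ} {b : ℝ≥0∞} (h : ‖x‖ₑ < 4 * b) :
    ENNReal.ofReal (‖x‖ / 4) < b := by
  rw [ENNReal.ofReal_div_of_pos four_pos, ofReal_norm]
  refine ENNReal.div_lt_of_lt_mul' ?_
  simpa using h

theorem exists_cassini_contours (hz : z ∈ cassiniAnnulus Ω Ω₀ z₁ z₂) (hz₁ : z₁ ∈ Ω₀)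
    (hz₂ : z₂ ∈ Ω₀) : ∃ (Γ₁ Γ₂ : Contour) (ρ₁ ρ₂ : ℝ),
      (∀ w ∈ Γ₁.trace, ‖(w - z₁) * (w - z₂)‖ = ρ₁) ∧
      (∀ w ∈ Γ₂.trace, ‖(w - z₁) * (w - z₂)‖ = ρ₂) ∧ 0 < ρ₂ ∧
      ρ₂ < ‖(z - z₁) * (z - z₂)‖ ∧ ‖(z - z₁) * (z - z₂)‖ < ρ₁ ∧
      Surrounds Ω Ω₀ Γ₁ ∧ Surrounds Ω Ω₀ Γ₂ ∧ Nested Ω Ω₀ z₁ z₂ z Γ₁ Γ₂ ∧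
      (‖(z₁ - z₂) ^ 2‖ₑ < 4 * outerRadius Ω z₁ z₂ → ∃ γ : Loop, Γ₁.loops = [γ]) ∧
      (‖(z₁ - z₂) ^ 2‖ₑ < 4 * ‖(z - z₁) * (z - z₂)‖ₑ → ∃ γ : Loop, Γ₂.loops = [γ]) := by
  -- The value `|z₁ - z₂|²/4` is the level of the lemniscate: it must be avoided, and above it the
  -- oval is a single loop. The levels satisfy `r₂ < ρ₂ < |P(z)| < ρ₁ < r₁`.
  obtain ⟨ρ₁, p₁, a₁, b₁, n₁, d₁⟩ := exists_real_between hz.2.2 (d := ‖(z₁ - z₂) ^ 2‖ / 4)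
  obtain ⟨ρ₂, p₂, a₂, b₂, n₂, d₂⟩ := exists_real_between hz.2.1 (d := ‖(z₁ - z₂) ^ 2‖ / 4)
  obtain ⟨Γ₁, s₁, t₁, e₁, -, l₁⟩ := exists_cassini_surrounds p₁
    (fun h => n₁ (by linarith)) (hz.2.1.trans a₁) b₁
  obtain ⟨Γ₂, s₂, t₂, -, x₂, l₂⟩ := exists_cassini_surrounds p₂
    (fun h => n₂ (by linarith)) a₂ (b₂.trans hz.2.2)
  have hzρ₁ := enorm_lt_ofReal_iff.1 a₁
  have hzρ₂ := (ofReal_lt_enorm_iff p₂.le).1 b₂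
  refine ⟨Γ₁, Γ₂, ρ₁, ρ₂, t₁, t₂, p₂, hzρ₂, hzρ₁, s₁, s₂, ?_, fun h => l₁ ?_, fun h => l₂ ?_⟩
  · exact ⟨s₁.subset, s₂.subset, ⟨s₁.encircles z₁ hz₁, s₁.encircles z₂ hz₂⟩,
      ⟨s₂.encircles z₁ hz₁, s₂.encircles z₂ hz₂⟩, x₂ z hzρ₂, e₁ z hzρ₁,
      fun w hw => e₁ w (by rw [t₂ w hw]; exact hzρ₂.trans hzρ₁), s₁.winding_eq s₂⟩
  · linarith [d₁ (ofReal_quarter_lt h)]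
  · linarith [d₂ (ofReal_quarter_lt h)]

end Annulus

/-! ### Convergence and conclusion -/

/-- Convergence of the two-point expansion in the Cassini annulus. -/
theorem convergence_in_cassiniAnnulus {Ω Ω₀ : Set ℂ} (hU : IsOpen (Ω \ Ω₀)) {f : ℂ → ℂ}
    (hf : DifferentiableOn ℂ f (Ω \ Ω₀)) {z₁ z₂ z : ℂ} (hz₁ : z₁ ∈ Ω₀) (hz₂ : z₂ ∈ Ω₀)
    (hne : z₁ ≠ z₂) (hz : z ∈ cassiniAnnulus Ω Ω₀ z₁ z₂) {Γ₁ Γ₂ : Contour}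
    (h₁ : Surrounds Ω Ω₀ Γ₁) (h₂ : Surrounds Ω Ω₀ Γ₂) :
    Summable (termB f Γ₁ z₁ z₂ z) ∧ Summable (termC f Γ₂ z₁ z₂ z) ∧
      f z = ∑' n, termB f Γ₁ z₁ z₂ z n + ∑' n, termC f Γ₂ z₁ z₂ z n := by
  -- The given contours are replaced by ovals adapted to `z`, which leaves all coefficients
  -- unchanged.
  obtain ⟨Δ₁, Δ₂, ρ₁, ρ₂, t₁, t₂, hρ₂, hzρ₂, hzρ₁, s₁, s₂, hn, -, -⟩ :=
    exists_cassini_contours hz hz₁ hz₂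
  have hB : termB f Γ₁ z₁ z₂ z = termB f Δ₁ z₁ z₂ z := funext fun n => by
    rw [termB, termB, h₁.coeffB_eq hU ⟨z, hz.1⟩ hf s₁ hz₁ hz₂,
      h₁.coeffB_eq hU ⟨z, hz.1⟩ hf s₁ hz₂ hz₁]
  have hC : termC f Γ₂ z₁ z₂ z = termC f Δ₂ z₁ z₂ z := funext fun n => by
    rw [termC, termC, h₂.coeffC_eq hU ⟨z, hz.1⟩ hf s₂, h₂.coeffC_eq hU ⟨z, hz.1⟩ hf s₂]
  have c₁ := hf.continuousOn.mono s₁.subset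
  have c₂ := hf.continuousOn.mono s₂.subset
  have sB := summable_termB c₁ t₁ hzρ₁
  have sC := summable_termC c₂ t₂ hρ₂ hzρ₂
  rw [hB, hC]
  refine ⟨sB, sC, ?_⟩
  have hlim := (sB.hasSum.tendsto_sum_nat.add sC.hasSum.tendsto_sum_nat).add
    (tendsto_remainder c₁ c₂ t₁ t₂ hzρ₁ hzρ₂ hρ₂)
  rw [add_zero] at hlim
  refine tendsto_nhds_unique (tendsto_const_nhds.congr fun N => ?_) hlim
  exact expansion_with_remainder hU hf hz₁ hz₂ hne hz.1 hn N

end TwoPointLaurent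

theorem theorem2 (Ω Ω₀ : Set ℂ) (hΩ : IsOpen Ω) (hΩ₀ : IsClosed Ω₀) (hsub : Ω₀ ⊆ Ω)
    (f : ℂ → ℂ) (hf : AnalyticOnNhd ℂ f (Ω \ Ω₀))
    (z₁ z₂ : ℂ) (hz₁ : z₁ ∈ Ω₀) (hz₂ : z₂ ∈ Ω₀) (hne : z₁ ≠ z₂) :
    -- the expansion with remainder
    (∀ z ∈ Ω \ Ω₀, ∀ Γ₁ Γ₂ : Contour, Nested Ω Ω₀ z₁ z₂ z Γ₁ Γ₂ → ∀ N : ℕ,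
      f z = ∑ n ∈ Finset.range N, termB f Γ₁ z₁ z₂ z n +
        ∑ n ∈ Finset.range N, termC f Γ₂ z₁ z₂ z n + remainder f Γ₁ Γ₂ z₁ z₂ z N) ∧
    -- convergence in the Cassini annulus, for all admissible contours
    (∀ Γ₁ Γ₂ : Contour, Surrounds Ω Ω₀ Γ₁ → Surrounds Ω Ω₀ Γ₂ →
      ∀ z ∈ cassiniAnnulus Ω Ω₀ z₁ z₂,
        (Nested Ω Ω₀ z₁ z₂ z Γ₁ Γ₂ →
          Tendsto (fun N => remainder f Γ₁ Γ₂ z₁ z₂ z N) atTop (𝓝 0)) ∧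
        Summable (termB f Γ₁ z₁ z₂ z) ∧ Summable (termC f Γ₂ z₁ z₂ z) ∧
        f z = ∑' n, termB f Γ₁ z₁ z₂ z n + ∑' n, termC f Γ₂ z₁ z₂ z n) ∧
    -- such contours exist at each point of the Cassini annulus
    (∀ z ∈ cassiniAnnulus Ω Ω₀ z₁ z₂, ∃ Γ₁ Γ₂ : Contour,
      Surrounds Ω Ω₀ Γ₁ ∧ Surrounds Ω Ω₀ Γ₂ ∧ Nested Ω Ω₀ z₁ z₂ z Γ₁ Γ₂ ∧
      (‖(z₁ - z₂) ^ 2‖ₑ < 4 * outerRadius Ω z₁ z₂ → ∃ γ : Loop, Γ₁.loops = [γ]) ∧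
      (‖(z₁ - z₂) ^ 2‖ₑ < 4 * ‖(z - z₁) * (z - z₂)‖ₑ → ∃ γ : Loop, Γ₂.loops = [γ])) := by
  have hU : IsOpen (Ω \ Ω₀) := hΩ.sdiff hΩ₀
  have hd := hf.differentiableOn
  refine ⟨fun z hz Γ₁ Γ₂ h N => expansion_with_remainder hU hd hz₁ hz₂ hne hz h N,
    fun Γ₁ Γ₂ h₁ h₂ z hz => ?_, fun z hz => ?_⟩
  · obtain ⟨sB, sC, hsum⟩ := convergence_in_cassiniAnnulus hU hd hz₁ hz₂ hne hz h₁ h₂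
    refine ⟨fun hn => ?_, sB, sC, hsum⟩
    -- On arbitrary contours `|P|` is not constant and the remainder is not estimated directly: by
    -- (i) it equals `f z` minus the partial sums, which converge to `f z`.
    have hlim := (tendsto_const_nhds (x := f z)).sub
      (sB.hasSum.tendsto_sum_nat.add sC.hasSum.tendsto_sum_nat)
    rw [← hsum, sub_self] at hlim
    refine hlim.congr fun N => ?_
    rw [sub_eq_iff_eq_add']
    exact expansion_with_remainder hU hd hz₁ hz₂ hne hz.1 hn N
  · obtain ⟨Γ₁, Γ₂, -, -, -, -, -, -, -, h⟩ := exists_cassini_contours hz hz₁ hz₂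
    exact ⟨Γ₁, Γ₂, h⟩
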